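/- **Setting.** Let $n\ge 1$ and $\alpha>0$. For $k\ge 1$ write $\mathbf x_k=(x_1,\dots,x_k)\in\mathbb R^{kn}$, and let $\mathrm H^\alpha_k$ be the space of kernels $\gamma=\gamma(\mathbf x_k;\mathbf x_k')\in L^2(\mathbb R^{kn}\times\mathbb R^{kn})$ (complex valued) with $$\|\gamma\|_{\mathrm H^\alpha_k}:=\Big\|\prod_{j=1}^k(1-\Delta_{x_j})^{\alpha/2}(1-\Delta_{x_j'})^{\alpha/2}\,\gamma\Big\|_{L^2}<\infty .$$ For $0<\xi<1$ let $\mathcal H^\alpha_\xi$ be the space of sequences $\Gamma=\{\gamma^{(k)}\}_{k\ge1}$, $\gamma^{(k)}\in\mathrm H^\alpha_k$, with $\|\Gamma\|_{\mathcal H^\alpha_\xi}:=\sum_{k\ge1}\xi^k\|\gamma^{(k)}\|_{\mathrm H^\alpha_k}<\infty$; the norm of $C([0,T],\mathcal H^\alpha_\xi)$ is the supremum over $t\in[0,T]$. Let $\mathcal U^{(k)}_0(t)\gamma=e^{it\Delta^{(k)}}\gamma\, e^{-it\Delta^{(k)}}$ with $\Delta^{(k)}=\sum_{j=1}^k\Delta_{x_j}$,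 that is, $\mathcal U_0^{(k)}(t)=\exp\big(it\sum_{j=1}^k(\Delta_{x_j}-\Delta_{x'_j})\big)$ on kernels. For $\alpha>n/2$ let $B^{(k)}:\mathrm H^\alpha_{k+1}\to\mathrm H^\alpha_k$ be the bounded extension of the operator given on Schwartz kernels by $$(B^{(k)}\gamma)(\mathbf x_k;\mathbf x_k')=\sum_{j=1}^k\big[\gamma(\mathbf x_k,x_j;\mathbf x_k',x_j)-\gamma(\mathbf x_k,x_j';\mathbf x_k',x_j')\big].$$ For $\mu\in\{1,-1\}$, a *(mild) solution* in $C([0,T],\mathcal H^\alpha_\xi)$ of the cubic Gross–Pitaevskii hierarchy $i\partial_t\gamma^{(k)}_t=[-\Delta^{(k)},\gamma^{(k)}_t]+\mu B^{(k)}\gamma^{(k+1)}_t$, $k\ge1$, is a $\Gamma_t=\{\gamma_t^{(k)}\}_{k\ge1}\in C([0,T],\mathcal H^\alpha_\xi)$ such that for all $k\ge1$ and $t\in[0,T]$ $$\gamma^{(k)}_t=\mathcal U^{(k)}_0(t)\gamma^{(k)}_0+\int_0^t\mathcal U^{(k)}_0(t-s)\,(-i\mu B^{(k)})\,\gamma^{(k+1)}_s\,ds\qquad\text{in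 }\mathrm H^\alpha_k .$$ **Theorem 2.1.** Let $n\ge1$ and $\alpha>n/2$. There is a constant $C=C_{\alpha,n}>0$ depending only on $n$ and $\alpha$ such that for every $\mu\in\{1,-1\}$ and every $0<\xi<1$ the following hold. (i) Let $\Gamma_0=\{\gamma^{(k)}_0\}_{k\ge1}\in\mathcal H^\alpha_\xi$, $0<T<\xi/C$ and $\eta=\xi-CT$. There is a solution $\Gamma_t\in C([0,T],\mathcal H^\alpha_\eta)$ of the hierarchy with $\Gamma_{t=0}=\Gamma_0$ and $$\|\Gamma_t\|_{C([0,T],\mathcal H^\alpha_\eta)}\le\frac{\eta}{\xi}\,\|\Gamma_0\|_{\mathcal H^\alpha_\xi}.$$ It is the limit in $C([0,T],\mathcal H^\alpha_\eta)$, as $m\to\infty$, of the iterates $\Gamma_{m,t}=\{\gamma^{(k)}_{m,t}\}_{k\ge1}\in C([0,T],\mathcal H^\alpha_\eta)$ of the Duhamel formula, which are given by $\gamma^{(k)}_{0,t}=\gamma^{(k)}_0$ and $$\gamma^{(k)}_{m,t}=\mathcal U^{(k)}_0(t)\gamma^{(k)}_0+\int_0^t\mathcal U^{(k)}_0(t-s)\,(-i\mu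 B^{(k)})\,\gamma^{(k+1)}_{m-1,s}\,ds\qquad(m\ge1).$$ (ii) Let $T=\xi/(5C)$ and $\eta=\xi-CT=\tfrac45\xi$. If $\Gamma_t,\Gamma_t'\in C([0,T],\mathcal H^\alpha_\eta)$ are two solutions with initial data $\Gamma_{t=0}=\Gamma_0$ and $\Gamma'_{t=0}=\Gamma_0'$ in $\mathcal H^\alpha_\xi$, then $$\|\Gamma_t-\Gamma_t'\|_{C([0,T],\mathcal H^\alpha_\eta)}\le\frac45\,\|\Gamma_0-\Gamma_0'\|_{\mathcal H^\alpha_\xi}.$$ Consequently, for every $0<T<\xi/C$ and $\eta=\xi-CT$, a solution in $C([0,T],\mathcal H^\alpha_\eta)$ with given initial data in $\mathcal H^\alpha_\xi$ is unique. -/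

import Mathlib

open MeasureTheory Filter Topology Set
open scoped FourierTransform SchwartzMap NNReal ENNReal

noncomputable section

namespace GP

/-! ### Configuration space and its Fourier side -/

/-- The space `ℝ^{kn} × ℝ^{kn}` of pairs `(x; x') = (x₁, …, x_k; x'₁, …, x'_k)`, with its Euclidean
norm and Lebesgue measure: the coordinates of `x_j ∈ ℝⁿ` are indexed by `(Sum.inl j, c)`, those of
`x'_j` by `(Sum.inr j, c)`, where `c : Fin n`. -/
abbrev Conf (n k : ℕ) : Type := EuclideanSpace ℝ ((Fin k ⊕ Fin k) × Fin n)

/-- The `ℝⁿ`-valued variable of a point of `Conf n k` in the slot `i`: it is `x_j` for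
`i = Sum.inl j` and `x'_j` for `i = Sum.inr j`. -/
def slot {n k : ℕ} (i : Fin k ⊕ Fin k) : Conf n k →L[ℝ] EuclideanSpace ℝ (Fin n) :=
  LinearMap.toContinuousLinearMap
    { toFun := fun x => WithLp.toLp 2 fun c => x (i, c)
      map_add' := fun _ _ => rfl
      map_smul' := fun _ _ => rfl }

/-- `L²(ℝ^{kn} × ℝ^{kn})`, complex valued. -/
abbrev L2 (n k : ℕ) : Type := Lp ℂ 2 (volume : Measure (Conf n k))

/-- The symbol of `S^{(k,α)} = ∏_j (1 - Δ_{x_j})^{α/2} (1 - Δ_{x'_j})^{α/2}`. With the convention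
`𝓕 f p = ∫ exp (-2πi⟨x, p⟩) f x dx` the operator `-Δ_{x_j}` is multiplication by `‖2π p_j‖²`. -/
def weight (n : ℕ) (α : ℝ≥0) (k : ℕ) (p : Conf n k) : ℝ :=
  ∏ i : Fin k ⊕ Fin k, (1 + ‖(2 * Real.pi) • slot i p‖ ^ 2) ^ ((α : ℝ) / 2)

/-- The symbol `exp (-it ∑_j (|2πp_j|² - |2πp'_j|²))` of `exp (it ∑_j (Δ_{x_j} - Δ_{x'_j}))`. -/
def phase (n k : ℕ) (t : ℝ) (p : Conf n k) : ℂ :=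
  Complex.exp (-Complex.I * t * ((∑ j : Fin k,
    (‖(2 * Real.pi) • slot (Sum.inl j) p‖ ^ 2 - ‖(2 * Real.pi) • slot (Sum.inr j) p‖ ^ 2) : ℝ) : ℂ))

theorem weight_hasTemperateGrowth (n : ℕ) (α : ℝ≥0) (k : ℕ) :
    (weight n α k).HasTemperateGrowth := by
  have h1 : ∀ i : Fin k ⊕ Fin k, (fun p : Conf n k =>
      (1 + ‖(2 * Real.pi) • slot i p‖ ^ 2) ^ ((α : ℝ) / 2)).HasTemperateGrowth := fun i =>
    (Function.hasTemperateGrowth_one_add_norm_sq_rpow (EuclideanSpace ℝ (Fin n))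
      ((α : ℝ) / 2)).comp
      (((2 * Real.pi) • slot i : Conf n k →L[ℝ] EuclideanSpace ℝ (Fin n)).hasTemperateGrowth)
  have h2 : ∀ s : Finset (Fin k ⊕ Fin k), (fun p : Conf n k =>
      ∏ i ∈ s, (1 + ‖(2 * Real.pi) • slot i p‖ ^ 2) ^ ((α : ℝ) / 2)).HasTemperateGrowth := by
    intro s
    induction s using Finset.induction_on with
    | empty => simp
    | insert a s ha ih =>
      simp only [Finset.prod_insert ha]
      exact (h1 a).mul ih
  exact h2 Finset.univ

theorem one_le_weight (n : ℕ) (α : ℝ≥0) (k : ℕ) (p : Conf n k) : 1 ≤ weight n α k p :=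
  Finset.prod_induction _ (fun x : ℝ => 1 ≤ x) (fun _ _ => one_le_mul_of_one_le_of_one_le)
    le_rfl fun _ _ => Real.one_le_rpow (le_add_of_nonneg_right (by positivity)) (by positivity)

theorem continuous_phase (n k : ℕ) (t : ℝ) : Continuous (phase n k t) := by
  unfold phase
  fun_prop

theorem norm_phase (n k : ℕ) (t : ℝ) (p : Conf n k) : ‖phase n k t p‖ = 1 := by
  unfold phase
  rw [Complex.norm_exp]
  simp [-Complex.ofReal_sum, -Complex.ofReal_sub]

theorem memLp_phase_mul {n k : ℕ} (t : ℝ) {f : Conf n k → ℂ} (hf : MemLp f 2) :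
    MemLp (fun p => phase n k t p * f p) 2 :=
  hf.of_le ((continuous_phase n k t).aestronglyMeasurable.mul hf.1)
    (Eventually.of_forall fun p => by simp [norm_phase])

/-! ### The Sobolev type spaces of kernels -/

/-- The kernels `γ ∈ L²` with `S^{(k,α)} γ ∈ L²`, as a subspace of `L²`. -/
def sobolevSubmodule (n : ℕ) (α : ℝ≥0) (k : ℕ) : Submodule ℂ (L2 n k) where
  carrier := {γ | MemLp (fun p => (weight n α k p : ℂ) * (𝓕 γ : L2 n k) p) 2}
  zero_mem' := by
    have : (fun p => (weight n α k p : ℂ) * (𝓕 (0 : L2 n k) : L2 n k) p) =ᵐ[volume] 0 := by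
      rw [FourierTransform.fourier_zero]
      filter_upwards [Lp.coeFn_zero ℂ 2 (volume : Measure (Conf n k))] with p hp
      exact (congrArg _ hp).trans (mul_zero _)
    exact (memLp_congr_ae this).2 MemLp.zero
  add_mem' := by
    intro a b ha hb
    refine (memLp_congr_ae ?_).2 (MemLp.add ha hb)
    rw [FourierTransform.fourier_add]
    filter_upwards [Lp.coeFn_add (𝓕 a : L2 n k) (𝓕 b)] with p hp
    exact (congrArg _ hp).trans (mul_add _ _ _)
  smul_mem' := by
    intro c a ha
    refine (memLp_congr_ae ?_).2 (MemLp.const_smul ha c)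
    rw [FourierTransform.fourier_smul]
    filter_upwards [Lp.coeFn_smul c (𝓕 a : L2 n k)] with p hp
    exact (congrArg _ hp).trans (mul_left_comm _ _ _)

/-- The space `H^α_k = H^α(ℝ^{kn} × ℝ^{kn})`, a type of its own because its norm is not the norm
of `L²`. -/
def Sob (n : ℕ) (α : ℝ≥0) (k : ℕ) : Type := sobolevSubmodule n α k

instance (n : ℕ) (α : ℝ≥0) (k : ℕ) : AddCommGroup (Sob n α k) :=
  inferInstanceAs (AddCommGroup (sobolevSubmodule n α k))

instance (n : ℕ) (α : ℝ≥0) (k : ℕ) : Module ℂ (Sob n α k) :=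
  inferInstanceAs (Module ℂ (sobolevSubmodule n α k))

/-- The kernel underlying an element of `H^α_k`, as an element of `L²`. -/
def Sob.toL2 {n : ℕ} {α : ℝ≥0} {k : ℕ} : Sob n α k →ₗ[ℂ] L2 n k :=
  (sobolevSubmodule n α k).subtype

theorem Sob.memLp {n : ℕ} {α : ℝ≥0} {k : ℕ} (γ : Sob n α k) :
    MemLp (fun p => (weight n α k p : ℂ) * (𝓕 γ.toL2 : L2 n k) p) 2 := γ.2

/-- The element of `H^α_k` with a given underlying kernel. -/
def Sob.mk {n : ℕ} {α : ℝ≥0} {k : ℕ} (γ : L2 n k)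
    (h : MemLp (fun p => (weight n α k p : ℂ) * (𝓕 γ : L2 n k) p) 2) : Sob n α k := ⟨γ, h⟩

theorem L2.fourierInv_fourier {n k : ℕ} (f : L2 n k) : 𝓕⁻ (𝓕 f : L2 n k) = f :=
  FourierTransform.fourierInv_fourier_eq f

theorem L2.fourier_fourierInv {n k : ℕ} (f : L2 n k) : 𝓕 (𝓕⁻ f : L2 n k) = f :=
  FourierTransform.fourier_fourierInv_eq f

/-- The operator `S^{(k,α)} : H^α_k → L²`. -/
def Sob.S {n : ℕ} {α : ℝ≥0} {k : ℕ} : Sob n α k →ₗ[ℂ] L2 n k where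
  toFun γ := 𝓕⁻ (MemLp.toLp (fun p => (weight n α k p : ℂ) * (𝓕 γ.toL2 : L2 n k) p) γ.memLp)
  map_add' γ ρ := by
    rw [← FourierTransform.fourierInv_add, ← MemLp.toLp_add]
    congr 1
    refine MemLp.toLp_congr _ _ ?_
    rw [map_add, FourierTransform.fourier_add]
    filter_upwards [Lp.coeFn_add (𝓕 γ.toL2 : L2 n k) (𝓕 ρ.toL2)] with p hp
    exact (congrArg _ hp).trans (mul_add _ _ _)
  map_smul' c γ := by
    rw [RingHom.id_apply, ← FourierTransform.fourierInv_smul, ← MemLp.toLp_const_smul]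
    congr 1
    refine MemLp.toLp_congr _ _ ?_
    rw [map_smul, FourierTransform.fourier_smul]
    filter_upwards [Lp.coeFn_smul c (𝓕 γ.toL2 : L2 n k)] with p hp
    exact (congrArg _ hp).trans (mul_left_comm _ _ _)

theorem Sob.fourier_S {n : ℕ} {α : ℝ≥0} {k : ℕ} (γ : Sob n α k) :
    (𝓕 (Sob.S γ) : L2 n k) =ᵐ[volume]
      fun p => (weight n α k p : ℂ) * (𝓕 γ.toL2 : L2 n k) p := by
  change (𝓕 (𝓕⁻ (MemLp.toLp _ γ.memLp) : L2 n k) : L2 n k) =ᵐ[volume] _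
  rw [L2.fourier_fourierInv]
  exact MemLp.coeFn_toLp _

theorem Sob.S_injective {n : ℕ} {α : ℝ≥0} {k : ℕ} :
    Function.Injective (Sob.S : Sob n α k → L2 n k) := by
  rw [injective_iff_map_eq_zero]
  intro γ h
  have h1 := Sob.fourier_S γ
  rw [h, FourierTransform.fourier_zero] at h1
  have h2 : (𝓕 γ.toL2 : L2 n k) = 0 := by
    rw [Lp.eq_zero_iff_ae_eq_zero]
    filter_upwards [h1, Lp.coeFn_zero ℂ 2 (volume : Measure (Conf n k))] with p hp hp0
    rw [hp0] at hp
    have hw : (weight n α k p : ℂ) ≠ 0 :=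
      Complex.ofReal_ne_zero.2 (zero_lt_one.trans_le (one_le_weight n α k p)).ne'
    simpa [hw] using hp.symm
  have h3 : γ.toL2 = 0 := by
    rw [← L2.fourierInv_fourier γ.toL2, h2, FourierTransform.fourierInv_zero]
  exact Subtype.ext h3

/-- The norm `‖γ‖_{H^α_k} = ‖S^{(k,α)} γ‖_{L²}`. -/
instance (n : ℕ) (α : ℝ≥0) (k : ℕ) : NormedAddCommGroup (Sob n α k) :=
  NormedAddCommGroup.induced _ _ Sob.S Sob.S_injective

instance (n : ℕ) (α : ℝ≥0) (k : ℕ) : NormedSpace ℂ (Sob n α k) :=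
  NormedSpace.induced ℂ _ _ Sob.S

theorem Sob.norm_eq {n : ℕ} {α : ℝ≥0} {k : ℕ} (γ : Sob n α k) : ‖γ‖ = ‖Sob.S γ‖ := rfl

theorem Sob.S_surjective {n : ℕ} {α : ℝ≥0} {k : ℕ} :
    Function.Surjective (Sob.S : Sob n α k → L2 n k) := by
  intro f
  have hne : ∀ p, (weight n α k p : ℂ) ≠ 0 := fun p =>
    Complex.ofReal_ne_zero.2 (zero_lt_one.trans_le (one_le_weight n α k p)).ne'
  have hc : Continuous (weight n α k) := (weight_hasTemperateGrowth n α k).1.continuous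
  have hm : MemLp (fun p => (weight n α k p : ℂ)⁻¹ * (𝓕 f : L2 n k) p) 2 := by
    refine (Lp.memLp (𝓕 f : L2 n k)).of_le (AEStronglyMeasurable.mul ?_ (Lp.memLp _).1)
      (Eventually.of_forall fun p => ?_)
    · exact ((Complex.continuous_ofReal.comp hc).inv₀ hne).aestronglyMeasurable
    · rw [norm_mul, norm_inv, Complex.norm_real, Real.norm_of_nonneg
        (zero_le_one.trans (one_le_weight n α k p))]
      exact mul_le_of_le_one_left (norm_nonneg _) (inv_le_one_of_one_le₀ (one_le_weight n α k p))
  have key : (fun p => (weight n α k p : ℂ) * (𝓕 (𝓕⁻ (hm.toLp _) : L2 n k) : L2 n k) p)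
      =ᵐ[volume] (𝓕 f : L2 n k) := by
    rw [L2.fourier_fourierInv]
    filter_upwards [hm.coeFn_toLp] with p hp
    rw [hp, mul_inv_cancel_left₀ (hne p)]
  let γ : Sob n α k := Sob.mk (𝓕⁻ (hm.toLp _)) ((memLp_congr_ae key).2 (Lp.memLp _))
  refine ⟨γ, ?_⟩
  have h1 : (𝓕 (Sob.S γ) : L2 n k) = 𝓕 f := Lp.ext ((Sob.fourier_S γ).trans key)
  rw [← L2.fourierInv_fourier (Sob.S γ), h1,
    L2.fourierInv_fourier]

instance (n : ℕ) (α : ℝ≥0) (k : ℕ) : CompleteSpace (Sob n α k) :=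
  (LinearIsometryEquiv.ofSurjective
    ⟨(Sob.S : Sob n α k →ₗ[ℂ] L2 n k), fun γ => (Sob.norm_eq γ).symm⟩
    Sob.S_surjective).toIsometryEquiv.completeSpace

/-! ### Free evolution -/

/-- The free evolution `γ ↦ exp (itΔ^{(k)}) γ exp (-itΔ^{(k)})`; on kernels it is the Fourier
multiplier `exp (it ∑_j (Δ_{x_j} - Δ_{x'_j}))`. -/
def freeEvolution {n : ℕ} {α : ℝ≥0} {k : ℕ} (t : ℝ) (γ : Sob n α k) : Sob n α k :=
  Sob.mk (𝓕⁻ ((memLp_phase_mul t (Lp.memLp (𝓕 γ.toL2 : L2 n k))).toLp _)) (by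
    refine (memLp_congr_ae ?_).2 (memLp_phase_mul t γ.memLp)
    rw [L2.fourier_fourierInv]
    filter_upwards [(memLp_phase_mul t (Lp.memLp (𝓕 γ.toL2 : L2 n k))).coeFn_toLp] with p hp
    rw [hp]
    exact mul_left_comm _ _ _)

/-! ### The interaction operator -/

/-- A Schwartz kernel as an element of `H^α_k`. -/
def schwartzToSob (n : ℕ) (α : ℝ≥0) (k : ℕ) : 𝓢(Conf n k, ℂ) →ₗ[ℂ] Sob n α k where
  toFun φ := Sob.mk (φ.toLp 2) (by
    have hw : (fun p => (weight n α k p : ℂ)).HasTemperateGrowth :=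
      Function.Complex.hasTemperateGrowth_ofReal.comp (weight_hasTemperateGrowth n α k)
    refine (memLp_congr_ae ?_).2 ((SchwartzMap.smulLeftCLM ℂ (fun p => (weight n α k p : ℂ))
      (𝓕 φ)).memLp 2)
    rw [SchwartzMap.toLp_fourier_eq]
    filter_upwards [(𝓕 φ).coeFn_toLp 2] with p hp
    rw [hp, SchwartzMap.smulLeftCLM_apply_apply hw, smul_eq_mul])
  map_add' _ _ := rfl
  map_smul' _ _ := rfl

/-- For a slot `a` of `ℝ^{kn} × ℝ^{kn}` this fills the two additional slots `x_{k+1}`, `x'_{k+1}`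
of `ℝ^{(k+1)n} × ℝ^{(k+1)n}` with the variable `a` and keeps all other slots. -/
def collapse {k : ℕ} (a : Fin k ⊕ Fin k) : Fin (k + 1) ⊕ Fin (k + 1) → Fin k ⊕ Fin k :=
  Sum.elim (Fin.snoc (α := fun _ => Fin k ⊕ Fin k) Sum.inl a)
    (Fin.snoc (α := fun _ => Fin k ⊕ Fin k) Sum.inr a)

/-- The map `(x; x') ↦ (x, a; x', a)`, where `a` is one of the variables `x_j`, `x'_j`. -/
def diag (n : ℕ) {k : ℕ} (a : Fin k ⊕ Fin k) : Conf n k →L[ℝ] Conf n (k + 1) :=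
  LinearMap.toContinuousLinearMap
    { toFun := fun x => WithLp.toLp 2 fun q => x (collapse a q.1, q.2)
      map_add' := fun _ _ => rfl
      map_smul' := fun _ _ => rfl }

theorem diag_antilipschitz (n : ℕ) {k : ℕ} (a : Fin k ⊕ Fin k) :
    AntilipschitzWith 1 (diag n a) := by
  refine AddMonoidHomClass.antilipschitz_of_bound _ fun x => ?_
  rw [NNReal.coe_one, one_mul, EuclideanSpace.norm_eq, EuclideanSpace.norm_eq]
  refine Real.sqrt_le_sqrt ?_
  let e : (Fin k ⊕ Fin k) × Fin n → (Fin (k + 1) ⊕ Fin (k + 1)) × Fin n :=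
    fun q => (Sum.map Fin.castSucc Fin.castSucc q.1, q.2)
  have he : Function.Injective e := by
    rintro ⟨i, c⟩ ⟨i', c'⟩ h
    simp only [e, Prod.mk.injEq] at h
    exact Prod.ext ((Sum.map_injective.2
      ⟨Fin.castSucc_injective k, Fin.castSucc_injective k⟩) h.1) h.2
  have hx : ∀ q, diag n a x (e q) = x q := by
    rintro ⟨i | i, c⟩ <;> simp [diag, e, collapse]
  calc ∑ q, ‖x q‖ ^ 2 = ∑ q, ‖diag n a x (e q)‖ ^ 2 := by simp only [hx]
    _ = ∑ q ∈ Finset.univ.map ⟨e, he⟩, ‖diag n a x q‖ ^ 2 := by simp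
    _ ≤ ∑ q, ‖diag n a x q‖ ^ 2 :=
      Finset.sum_le_sum_of_subset_of_nonneg (Finset.subset_univ _) fun _ _ _ => by positivity

/-- The restriction of a Schwartz kernel to the diagonal `x_{k+1} = x'_{k+1} = a`, that is
`(x; x') ↦ ∫ δ(x_{k+1} - x'_{k+1}) δ(a - x_{k+1}) φ(x, x_{k+1}; x', x'_{k+1}) dx_{k+1} dx'_{k+1}`. -/
def restrictDiag (n : ℕ) {k : ℕ} (a : Fin k ⊕ Fin k) :
    𝓢(Conf n (k + 1), ℂ) →L[ℂ] 𝓢(Conf n k, ℂ) :=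
  SchwartzMap.compCLMOfAntilipschitz ℂ (diag n a).hasTemperateGrowth (diag_antilipschitz n a)

/-- The interaction operator `B^{(k)} = ∑_j tr_{k+1} [δ(x_j - x_{k+1}), · ]` on Schwartz kernels:
`φ ↦ ∑_j (φ(x, x_j; x', x_j) - φ(x, x'_j; x', x'_j))`. -/
def interactionSchwartz (n k : ℕ) : 𝓢(Conf n (k + 1), ℂ) →L[ℂ] 𝓢(Conf n k, ℂ) :=
  ∑ j : Fin k, (restrictDiag n (Sum.inl j) - restrictDiag n (Sum.inr j))

/-- The interaction operator `B^{(k)} : H^α_{k+1} → H^α_k`: the bounded extension from Schwartz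
kernels (Schwartz kernels are dense in `H^α_{k+1}`, and the extension exists for `α > n/2`). -/
def interaction (n : ℕ) (α : ℝ≥0) (k : ℕ) : Sob n α (k + 1) →L[ℂ] Sob n α k :=
  (schwartzToSob n α k ∘ₗ (interactionSchwartz n k).toLinearMap).extendOfNorm
    (schwartzToSob n α (k + 1))

/-! ### Sequences of kernels and the hierarchy -/

/-- Sequences `Γ = {γ^{(k)}}_{k ≥ 1}` with `γ^{(k)} ∈ H^α_k`; the entry `Γ k` is `γ^{(k+1)}`. -/
abbrev Seq (n : ℕ) (α : ℝ≥0) : Type := ∀ k : ℕ, Sob n α (k + 1)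

/-- The space `𝓗^α_ξ` of the sequences with `∑_{k ≥ 1} ξ^k ‖γ^{(k)}‖ < ∞`. -/
def HSpace (n : ℕ) (α : ℝ≥0) (ξ : ℝ) : Set (Seq n α) :=
  {Γ | Summable fun k => ξ ^ (k + 1) * ‖Γ k‖}

/-- The norm `∑_{k ≥ 1} ξ^k ‖γ^{(k)}‖` of `𝓗^α_ξ`. -/
def hnorm {n : ℕ} {α : ℝ≥0} (ξ : ℝ) (Γ : Seq n α) : ℝ := ∑' k, ξ ^ (k + 1) * ‖Γ k‖

/-- `Γ ∈ C([0,T], 𝓗^α_ξ)`; only the values of `Γ` on `[0,T]` matter. -/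
structure MemC {n : ℕ} {α : ℝ≥0} (T ξ : ℝ) (Γ : ℝ → Seq n α) : Prop where
  mem : ∀ t ∈ Icc 0 T, Γ t ∈ HSpace n α ξ
  cont : ∀ t₀ ∈ Icc 0 T, Tendsto (fun t => hnorm ξ (Γ t - Γ t₀)) (𝓝[Icc 0 T] t₀) (𝓝 0)

/-- The integrand `U^{(k)}(t - s) (-iμ B^{(k)}) γ^{(k+1)}_s` of the Duhamel term, for the entry with
index `k` of the sequence. -/
def duhamelIntegrand {n : ℕ} {α : ℝ≥0} (μ : ℝ) (Γ : ℝ → Seq n α) (k : ℕ) (t s : ℝ) :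
    Sob n α (k + 1) :=
  freeEvolution (t - s) ((-Complex.I * μ) • interaction n α (k + 1) (Γ s (k + 1)))

/-- `Γ ∈ C([0,T], 𝓗^α_ξ)` is a mild solution on `[0,T]` of the cubic Gross-Pitaevskii hierarchy:
for all `k` and all `t ∈ [0,T]` the identity
`γ^{(k)}_t = U^{(k)}(t) γ^{(k)}_0 + ∫₀ᵗ U^{(k)}(t-s) (-iμ B^{(k)}) γ^{(k+1)}_s ds`
holds in `H^α_k`, with a Bochner integral in `H^α_k`. -/
structure IsMildSolution {n : ℕ} {α : ℝ≥0} (μ T ξ : ℝ) (Γ : ℝ → Seq n α) : Prop where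
  memC : MemC T ξ Γ
  integrable : ∀ k, ∀ t ∈ Icc 0 T, IntervalIntegrable (duhamelIntegrand μ Γ k t) volume 0 t
  eq : ∀ k, ∀ t ∈ Icc 0 T,
    Γ t k = freeEvolution t (Γ 0 k) + ∫ s in (0 : ℝ)..t, duhamelIntegrand μ Γ k t s

/-- The iterated Duhamel expansion: `Γ_{0,t} = Γ₀` and
`γ^{(k)}_{m+1,t} = U^{(k)}(t) γ^{(k)}_0 + ∫₀ᵗ U^{(k)}(t-s) (-iμ B^{(k)}) γ^{(k+1)}_{m,s} ds`. -/
def duhamelIterate {n : ℕ} {α : ℝ≥0} (μ : ℝ) (Γ₀ : Seq n α) : ℕ → ℝ → Seq n α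
  | 0 => fun _ => Γ₀
  | m + 1 => fun t k => freeEvolution t (Γ₀ k) +
      ∫ s in (0 : ℝ)..t, duhamelIntegrand μ (duhamelIterate μ Γ₀ m) k t s

end GP

end

/-! Two estimates carry the proof. The free evolution is a strongly continuous family of isometries
of each `H^α_k`, since its symbol is unimodular and commutes with the weight. The operator `B^{(k)}`
has norm at most `C k`: it consists of `2k` restrictions to diagonals, each bounded uniformly in
`k`.

On the Fourier side a restriction integrates out momenta: the slot momentum `u` and the two last
momenta `v`, `w` merge into `u + v + w`. Testing against the weighted transform itself and applying
Cauchy-Schwarz leaves the squared ratio of the two weights, integrated over `u, v, w` with fixed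
sum. As `⟨u + v + w⟩^{2α} ≤ 9^α (⟨u⟩^{2α} + ⟨v⟩^{2α} + ⟨w⟩^{2α})`, this is controlled by products of
two factors `⟨·⟩^{-2α}`, which are integrable because `2α > n` (`lintegral_weight_ratio_mul_le`,
`norm_interaction_apply_le`).

Iterating Duhamel `j` times multiplies `j` consecutive norms of `B`, while the time simplex
contributes `t^j / j!`. With the index shift of `Seq`, the `j`-th term for entry `k` is at most
`(Ct)^j binom(k+j, k) ‖Γ₀ (k+j)‖`, which is `duhamelBound`. Weighting by `η^(k+1)` and summing over
`k + j = N`, the binomial theorem gives exactly `η (η + Ct)^N`; hence the factor `η/ξ` when `η + CT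
= ξ` (`hasSum_duhamelBound`).

Existence follows since the increments of the iterates are dominated by such terms. For the
difference of two solutions the same iteration leaves a remainder built from the a priori bound `K /
η^(k+1)`; it vanishes when `CT < η` (`norm_le_tsum_duhamelBound`), which gives stability. Uniqueness
on longer intervals follows by restarting with a step that depends only on `η`. -/

noncomputable section

namespace GP

/-! ### Splitting off the last pair of variables -/

/-- The point of `ℝ^{(k+1)n} × ℝ^{(k+1)n}` with first `k` pairs of variables given by `p` and with
last pair of variables `(q, q')`. -/
def join {n k : ℕ}
    (z : Conf n k × EuclideanSpace ℝ (Fin n) × EuclideanSpace ℝ (Fin n)) : Conf n (k + 1) :=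
  WithLp.toLp 2 fun ic => Sum.elim
    (Fin.snoc (α := fun _ => ℝ) (fun j => z.1 (Sum.inl j, ic.2)) (z.2.1 ic.2))
    (Fin.snoc (α := fun _ => ℝ) (fun j => z.1 (Sum.inr j, ic.2)) (z.2.2 ic.2)) ic.1

/-- The splitting of the coordinates underlying `join`. -/
def splitIndex (n k : ℕ) : ((Fin k ⊕ Fin k) × Fin n) ⊕ (Fin n ⊕ Fin n) ≃
    (Fin (k + 1) ⊕ Fin (k + 1)) × Fin n where
  toFun := Sum.elim (fun ic => (Sum.map Fin.castSucc Fin.castSucc ic.1, ic.2))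
    (Sum.elim (fun c => (Sum.inl (Fin.last k), c)) fun c => (Sum.inr (Fin.last k), c))
  invFun ic := Sum.elim
    (Fin.snoc (α := fun _ => ((Fin k ⊕ Fin k) × Fin n) ⊕ (Fin n ⊕ Fin n))
      (fun j => Sum.inl (Sum.inl j, ic.2)) (Sum.inr (Sum.inl ic.2)))
    (Fin.snoc (α := fun _ => ((Fin k ⊕ Fin k) × Fin n) ⊕ (Fin n ⊕ Fin n))
      (fun j => Sum.inl (Sum.inr j, ic.2)) (Sum.inr (Sum.inr ic.2))) ic.1
  left_inv := by
    rintro (⟨i | i, c⟩ | c | c) <;> simp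
  right_inv := by
    rintro ⟨i | i, c⟩ <;> refine Fin.lastCases ?_ (fun j => ?_) i <;> simp

/-- Volume on a Euclidean space is the product measure of the coordinates, and `join` only relabels
coordinates along `splitIndex`. -/
theorem measurePreserving_join (n k : ℕ) : MeasurePreserving (join (n := n) (k := k)) := by
  have h1 : MeasurePreserving
      (fun z : Conf n k × EuclideanSpace ℝ (Fin n) × EuclideanSpace ℝ (Fin n) =>
        (WithLp.ofLp z.1, WithLp.ofLp z.2.1, WithLp.ofLp z.2.2)) :=
    (PiLp.volume_preserving_ofLp _).prod
      ((PiLp.volume_preserving_ofLp _).prod (PiLp.volume_preserving_ofLp _))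
  have h2 : MeasurePreserving
      (Prod.map id (MeasurableEquiv.sumPiEquivProdPi fun _ : Fin n ⊕ Fin n => ℝ).symm :
        ((Fin k ⊕ Fin k) × Fin n → ℝ) × (Fin n → ℝ) × (Fin n → ℝ) → _) :=
    (MeasurePreserving.id volume).prod (volume_measurePreserving_sumPiEquivProdPi_symm _)
  have h3 := volume_measurePreserving_sumPiEquivProdPi_symm
    fun _ : ((Fin k ⊕ Fin k) × Fin n) ⊕ (Fin n ⊕ Fin n) => ℝ
  have h4 := volume_measurePreserving_piCongrLeft
    (fun _ : (Fin (k + 1) ⊕ Fin (k + 1)) × Fin n => ℝ) (splitIndex n k)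
  have h := (PiLp.volume_preserving_toLp _).comp (h4.comp (h3.comp (h2.comp h1)))
  convert h using 1
  funext z
  refine congrArg (WithLp.toLp 2) (funext fun ic => ?_)
  obtain ⟨ic, rfl⟩ := (splitIndex n k).surjective ic
  simp only [Function.comp_apply]
  erw [MeasurableEquiv.piCongrLeft_apply_apply]
  rcases ic with ⟨i | i, c⟩ | c | c <;> simp [splitIndex] <;> rfl

@[simp]
theorem slot_apply {n k : ℕ} (i : Fin k ⊕ Fin k) (x : Conf n k) (c : Fin n) :
    slot i x c = x (i, c) := rfl

theorem slot_inl_castSucc_join {n k : ℕ} (j : Fin k)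
    (z : Conf n k × EuclideanSpace ℝ (Fin n) × EuclideanSpace ℝ (Fin n)) :
    slot (Sum.inl j.castSucc) (join z) = slot (Sum.inl j) z.1 := by
  ext c; simp [join]

theorem slot_inr_castSucc_join {n k : ℕ} (j : Fin k)
    (z : Conf n k × EuclideanSpace ℝ (Fin n) × EuclideanSpace ℝ (Fin n)) :
    slot (Sum.inr j.castSucc) (join z) = slot (Sum.inr j) z.1 := by
  ext c; simp [join]

theorem slot_inl_last_join {n k : ℕ}
    (z : Conf n k × EuclideanSpace ℝ (Fin n) × EuclideanSpace ℝ (Fin n)) :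
    slot (Sum.inl (Fin.last k)) (join z) = z.2.1 := by
  ext c; simp [join]

theorem slot_inr_last_join {n k : ℕ}
    (z : Conf n k × EuclideanSpace ℝ (Fin n) × EuclideanSpace ℝ (Fin n)) :
    slot (Sum.inr (Fin.last k)) (join z) = z.2.2 := by
  ext c; simp [join]

/-- The point of `ℝ^{kn} × ℝ^{kn}` with variable `v` in the slot `a` and zeros elsewhere. -/
def inject {n k : ℕ} (a : Fin k ⊕ Fin k) (v : EuclideanSpace ℝ (Fin n)) : Conf n k :=
  WithLp.toLp 2 fun ic => if ic.1 = a then v ic.2 else 0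

theorem slot_inject {n k : ℕ} (a i : Fin k ⊕ Fin k) (v : EuclideanSpace ℝ (Fin n)) :
    slot i (inject a v) = if i = a then v else 0 := by
  ext c
  by_cases h : i = a <;> simp [inject, h]

/-- The transpose of copying a variable is summation: both extra momenta are added to the slot `a`
that was copied. -/
theorem adjoint_diag_join {n k : ℕ} (a : Fin k ⊕ Fin k)
    (z : Conf n k × EuclideanSpace ℝ (Fin n) × EuclideanSpace ℝ (Fin n)) :
    ContinuousLinearMap.adjoint (diag n a) (join z) = z.1 + inject a (z.2.1 + z.2.2) := by
  refine ext_inner_left ℝ fun x => ?_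
  have h : ∀ v : EuclideanSpace ℝ (Fin n), inner ℝ x (inject a v) = ∑ c, x (a, c) * v c := by
    intro v
    simp only [PiLp.inner_apply, RCLike.inner_apply, conj_trivial, Fintype.sum_prod_type, inject]
    rw [Finset.sum_eq_single a]
    · simp [mul_comm]
    · intro b _ hb; simp [hb]
    · simp
  rw [ContinuousLinearMap.adjoint_inner_right, inner_add_right, h]
  simp only [PiLp.inner_apply, RCLike.inner_apply, conj_trivial, Fintype.sum_prod_type,
    Fintype.sum_sum_type, Fin.sum_univ_castSucc, join, diag, collapse]
  simp [mul_add, Finset.sum_add_distrib, mul_comm]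
  ring

/-! ### The weight -/

/-- The symbol of `(1 - Δ)^{α/2}` on `ℝⁿ`. -/
def bracket {n : ℕ} (α : ℝ≥0) (v : EuclideanSpace ℝ (Fin n)) : ℝ :=
  (1 + ‖(2 * Real.pi) • v‖ ^ 2) ^ ((α : ℝ) / 2)

theorem bracket_pos {n : ℕ} (α : ℝ≥0) (v : EuclideanSpace ℝ (Fin n)) : 0 < bracket α v :=
  Real.rpow_pos_of_pos (by positivity) _

theorem measurable_bracket {n : ℕ} (α : ℝ≥0) :
    Measurable (bracket α : EuclideanSpace ℝ (Fin n) → ℝ) := by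
  unfold bracket
  fun_prop

theorem weight_eq_prod_bracket (n : ℕ) (α : ℝ≥0) (k : ℕ) (p : Conf n k) :
    weight n α k p = ∏ i, bracket α (slot i p) := rfl

theorem weight_pos (n : ℕ) (α : ℝ≥0) (k : ℕ) (p : Conf n k) : 0 < weight n α k p :=
  zero_lt_one.trans_le (one_le_weight n α k p)

theorem weight_join {n : ℕ} (α : ℝ≥0) {k : ℕ}
    (z : Conf n k × EuclideanSpace ℝ (Fin n) × EuclideanSpace ℝ (Fin n)) :
    weight n α (k + 1) (join z) = weight n α k z.1 * bracket α z.2.1 * bracket α z.2.2 := by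
  simp only [weight_eq_prod_bracket, Fintype.prod_sum_type, Fin.prod_univ_castSucc,
    slot_inl_castSucc_join, slot_inr_castSucc_join, slot_inl_last_join, slot_inr_last_join]
  ring

/-- Only the factor of slot `a` sees the shift, so all the others cancel. This makes the restriction
bound independent of `k`. -/
theorem weight_add_inject {n : ℕ} (α : ℝ≥0) {k : ℕ} (a : Fin k ⊕ Fin k) (p : Conf n k)
    (v : EuclideanSpace ℝ (Fin n)) :
    weight n α k (p + inject a v) * bracket α (slot a p) =
      weight n α k p * bracket α (slot a p + v) := by
  simp only [weight_eq_prod_bracket, map_add, slot_inject]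
  rw [← Finset.mul_prod_erase Finset.univ _ (Finset.mem_univ a),
    ← Finset.mul_prod_erase Finset.univ (fun i => bracket α (slot i p)) (Finset.mem_univ a)]
  have : ∏ x ∈ Finset.univ.erase a, bracket α (slot x p + if x = a then v else 0) =
      ∏ x ∈ Finset.univ.erase a, bracket α (slot x p) :=
    Finset.prod_congr rfl fun i hi => by rw [if_neg (Finset.ne_of_mem_erase hi), add_zero]
  rw [this, if_pos rfl]
  ring

theorem bracket_sq {n : ℕ} (α : ℝ≥0) (v : EuclideanSpace ℝ (Fin n)) :
    bracket α v ^ 2 = (1 + ‖(2 * Real.pi) • v‖ ^ 2) ^ (α : ℝ) := by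
  rw [bracket, ← Real.rpow_natCast, ← Real.rpow_mul (by positivity)]
  norm_num

/-- The norm of the sum is at most three times the largest of the three norms, and `1 + 9 s ≤ 9 (1 +
s)`. The case split only finds the largest vector. -/
theorem bracket_add_add_sq_le {n : ℕ} (α : ℝ≥0) (u v w : EuclideanSpace ℝ (Fin n)) :
    bracket α (u + v + w) ^ 2 ≤
      9 ^ (α : ℝ) * (bracket α u ^ 2 + bracket α v ^ 2 + bracket α w ^ 2) := by
  have key : ∀ y : EuclideanSpace ℝ (Fin n), ‖u‖ ≤ ‖y‖ → ‖v‖ ≤ ‖y‖ → ‖w‖ ≤ ‖y‖ →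
      bracket α (u + v + w) ^ 2 ≤ 9 ^ (α : ℝ) * bracket α y ^ 2 := by
    intro y hu hv hw
    rw [bracket_sq, bracket_sq, ← Real.mul_rpow (by norm_num) (by positivity)]
    refine Real.rpow_le_rpow (by positivity) ?_ α.2
    have h1 : ‖u + v + w‖ ≤ 3 * ‖y‖ := (norm_add₃_le).trans (by linarith)
    have h2 : ‖u + v + w‖ ^ 2 ≤ (3 * ‖y‖) ^ 2 := pow_le_pow_left₀ (norm_nonneg _) h1 2
    rw [norm_smul, norm_smul, mul_pow, mul_pow]
    nlinarith [sq_nonneg ‖(2 * Real.pi : ℝ)‖,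
      mul_le_mul_of_nonneg_left h2 (sq_nonneg ‖(2 * Real.pi : ℝ)‖)]
  have h9 : (0 : ℝ) < 9 ^ (α : ℝ) := by positivity
  have hu := mul_pos h9 (pow_pos (bracket_pos α u) 2)
  have hv := mul_pos h9 (pow_pos (bracket_pos α v) 2)
  have hw := mul_pos h9 (pow_pos (bracket_pos α w) 2)
  rw [mul_add, mul_add]
  rcases le_total ‖u‖ ‖v‖ with h1 | h1 <;> rcases le_total ‖v‖ ‖w‖ with h2 | h2 <;>
    rcases le_total ‖u‖ ‖w‖ with h3 | h3
  · linarith [key w h3 h2 le_rfl]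
  · linarith [key w (h1.trans h2) h2 le_rfl]
  · linarith [key v h1 le_rfl h2]
  · linarith [key v h1 le_rfl h2]
  · linarith [key w h3 h2 le_rfl]
  · linarith [key u le_rfl h1 h3]
  · linarith [key u le_rfl h1 (h2.trans h1)]
  · linarith [key u le_rfl h1 h3]

/-- `∫ (1 + |2πv|²)^{-α} dv`. -/
def bracketIntegral (n : ℕ) (α : ℝ≥0) : ℝ≥0∞ :=
  ∫⁻ v : EuclideanSpace ℝ (Fin n), ENNReal.ofReal ((bracket α v ^ 2)⁻¹)

/-- The condition `α > n/2` enters the whole proof through this integrability alone. -/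
theorem bracketIntegral_ne_top {n : ℕ} {α : ℝ≥0} (hα : (n : ℝ) / 2 < α) :
    bracketIntegral n α ≠ ∞ := by
  have h : Integrable
      (fun v : EuclideanSpace ℝ (Fin n) => ((1 : ℝ) + ‖v‖ ^ 2) ^ (-(2 * α : ℝ) / 2)) :=
    integrable_rpow_neg_one_add_norm_sq (by
      rw [finrank_euclideanSpace_fin]; linarith)
  refine ne_top_of_le_ne_top h.lintegral_lt_top.ne (lintegral_mono fun v => ?_)
  refine ENNReal.ofReal_le_ofReal ?_
  rw [bracket_sq, ← Real.rpow_neg (by positivity)]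
  have : (-(2 * α : ℝ) / 2) = -α := by ring
  rw [this]
  refine Real.rpow_le_rpow_of_nonpos (by positivity) ?_ (by simp)
  rw [norm_smul, mul_pow, Real.norm_of_nonneg (by positivity)]
  have : 1 ≤ (2 * Real.pi) ^ 2 := one_le_pow₀ (by linarith [Real.pi_gt_three])
  nlinarith [sq_nonneg ‖v‖]

/-! ### The restriction to the diagonal -/

/-- `(1 + |2πv|²)^{-α}`. -/
def invBracketSq {n : ℕ} (α : ℝ≥0) (v : EuclideanSpace ℝ (Fin n)) : ℝ≥0∞ :=
  ENNReal.ofReal ((bracket α v ^ 2)⁻¹)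

theorem measurable_invBracketSq {n : ℕ} (α : ℝ≥0) :
    Measurable (invBracketSq α : EuclideanSpace ℝ (Fin n) → ℝ≥0∞) :=
  (((measurable_bracket α).pow_const 2).inv).ennreal_ofReal

/-- The sum of the pairwise products of the values of `(1 + |2πv|²)^{-α}`. -/
def bracketKernel {n : ℕ} (α : ℝ≥0) (u v w : EuclideanSpace ℝ (Fin n)) : ℝ≥0∞ :=
  invBracketSq α v * invBracketSq α w + invBracketSq α u * invBracketSq α w +
    invBracketSq α u * invBracketSq α v

/-- The three arguments have constant sum `u`, and any two of them are free coordinates on the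
fibre. By translation invariance each of the three products integrates to the same square, whatever
`u` is. -/
theorem lintegral_bracketKernel {n : ℕ} (α : ℝ≥0) (u : EuclideanSpace ℝ (Fin n)) :
    ∫⁻ y : EuclideanSpace ℝ (Fin n) × EuclideanSpace ℝ (Fin n),
      bracketKernel α (u - (y.1 + y.2)) y.1 y.2 = 3 * bracketIntegral n α ^ 2 := by
  have hm := measurable_invBracketSq (n := n) α
  have h1 : ∫⁻ y : EuclideanSpace ℝ (Fin n) × EuclideanSpace ℝ (Fin n),
      invBracketSq α y.1 * invBracketSq α y.2 = bracketIntegral n α ^ 2 := by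
    rw [Measure.volume_eq_prod, lintegral_prod_mul hm.aemeasurable hm.aemeasurable, sq]
    rfl
  have h2 : ∫⁻ y : EuclideanSpace ℝ (Fin n) × EuclideanSpace ℝ (Fin n),
      invBracketSq α (u - (y.1 + y.2)) * invBracketSq α y.2 = bracketIntegral n α ^ 2 := by
    rw [Measure.volume_eq_prod, lintegral_prod_symm' _ (by fun_prop)]
    have : ∀ w : EuclideanSpace ℝ (Fin n), ∫⁻ v : EuclideanSpace ℝ (Fin n),
        invBracketSq α (u - (v + w)) * invBracketSq α w =
          bracketIntegral n α * invBracketSq α w := by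
      intro w
      rw [lintegral_mul_const _ (by fun_prop)]
      simp_rw [add_comm _ w, ← sub_sub]
      rw [lintegral_sub_left_eq_self (invBracketSq α)]
      rfl
    simp_rw [this]
    rw [lintegral_const_mul _ hm, sq]
    rfl
  have h3 : ∫⁻ y : EuclideanSpace ℝ (Fin n) × EuclideanSpace ℝ (Fin n),
      invBracketSq α (u - (y.1 + y.2)) * invBracketSq α y.1 = bracketIntegral n α ^ 2 := by
    rw [Measure.volume_eq_prod, lintegral_prod _ (by fun_prop)]
    have : ∀ v : EuclideanSpace ℝ (Fin n), ∫⁻ w : EuclideanSpace ℝ (Fin n),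
        invBracketSq α (u - (v + w)) * invBracketSq α v =
          bracketIntegral n α * invBracketSq α v := by
      intro v
      rw [lintegral_mul_const _ (by fun_prop)]
      simp_rw [← sub_sub]
      rw [lintegral_sub_left_eq_self (invBracketSq α)]
      rfl
    simp_rw [this]
    rw [lintegral_const_mul _ hm, sq]
    rfl
  unfold bracketKernel
  rw [lintegral_add_left (by fun_prop), lintegral_add_left (by fun_prop), h1, h2, h3]
  ring

/-- The constant in the bound for the restriction to the diagonal. -/
def restrictConst (n : ℕ) (α : ℝ≥0) : ℝ≥0∞ :=
  ENNReal.ofReal (9 ^ (α : ℝ)) * (3 * bracketIntegral n α ^ 2)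

theorem restrictConst_ne_top {n : ℕ} {α : ℝ≥0} (hα : (n : ℝ) / 2 < α) :
    restrictConst n α ≠ ∞ :=
  ENNReal.mul_ne_top ENNReal.ofReal_ne_top
    (ENNReal.mul_ne_top (by norm_num) (ENNReal.pow_ne_top (bracketIntegral_ne_top hα)))

theorem weight_ratio_sq_le {n : ℕ} (α : ℝ≥0) {k : ℕ} (a : Fin k ⊕ Fin k)
    (z : Conf n k × EuclideanSpace ℝ (Fin n) × EuclideanSpace ℝ (Fin n)) :
    ENNReal.ofReal ((weight n α k (z.1 + inject a (z.2.1 + z.2.2)) /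
      weight n α (k + 1) (join z)) ^ 2) ≤
      ENNReal.ofReal (9 ^ (α : ℝ)) * bracketKernel α (slot a z.1) z.2.1 z.2.2 := by
  obtain ⟨p, q, r⟩ := z
  have hu := bracket_pos α (slot a p)
  have hq := bracket_pos α q
  have hr := bracket_pos α r
  have hp := weight_pos n α k p
  have h1 := weight_add_inject α a p (q + r)
  rw [← add_assoc] at h1
  have h2 := bracket_add_add_sq_le α (slot a p) q r
  unfold bracketKernel invBracketSq
  rw [← ENNReal.ofReal_mul (by positivity), ← ENNReal.ofReal_mul (by positivity),
    ← ENNReal.ofReal_mul (by positivity), ← ENNReal.ofReal_add (by positivity) (by positivity),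
    ← ENNReal.ofReal_add (by positivity) (by positivity), ← ENNReal.ofReal_mul (by positivity)]
  refine ENNReal.ofReal_le_ofReal ?_
  rw [weight_join]
  simp only
  rw [eq_div_of_mul_eq hu.ne' h1]
  calc _ = bracket α (slot a p + q + r) ^ 2 *
        (bracket α (slot a p) ^ 2 * bracket α q ^ 2 * bracket α r ^ 2)⁻¹ := by
        field_simp
    _ ≤ (9 ^ (α : ℝ) * (bracket α (slot a p) ^ 2 + bracket α q ^ 2 + bracket α r ^ 2)) *
        (bracket α (slot a p) ^ 2 * bracket α q ^ 2 * bracket α r ^ 2)⁻¹ := by gcongr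
    _ = _ := by field_simp

theorem measurable_weight (n : ℕ) (α : ℝ≥0) (k : ℕ) : Measurable (weight n α k) :=
  (weight_hasTemperateGrowth n α k).1.continuous.measurable

theorem measurable_inject {n k : ℕ} (a : Fin k ⊕ Fin k) :
    Measurable (inject a : EuclideanSpace ℝ (Fin n) → Conf n k) := by
  refine (WithLp.measurable_toLp 2 _).comp (measurable_pi_lambda _ fun ic => ?_)
  by_cases h : ic.1 = a
  · simp only [h, if_true]; fun_prop
  · simp only [h, if_false]; fun_prop

/-- Integration along the fibres of the adjoint of `diag`. In the coordinates of `join`, translating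
the first component turns the argument of `f` into `p`; the remaining integral over the last pair of
momenta is the constant of `lintegral_bracketKernel`. -/
theorem lintegral_weight_ratio_mul_le {n : ℕ} (α : ℝ≥0) {k : ℕ} (a : Fin k ⊕ Fin k)
    {f : Conf n k → ℝ≥0∞} (hf : Measurable f) :
    ∫⁻ P, ENNReal.ofReal ((weight n α k (ContinuousLinearMap.adjoint (diag n a) P) /
        weight n α (k + 1) P) ^ 2) * f (ContinuousLinearMap.adjoint (diag n a) P) ≤
      restrictConst n α * ∫⁻ p, f p := by
  have hA : Measurable (ContinuousLinearMap.adjoint (diag n a)) :=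
    (ContinuousLinearMap.adjoint (diag n a)).continuous.measurable
  have hw := measurable_weight n α k
  have hw1 := measurable_weight n α (k + 1)
  have hi := measurable_inject (n := n) a
  have hm := measurable_invBracketSq (n := n) α
  have hs : Measurable (slot a : Conf n k → EuclideanSpace ℝ (Fin n)) :=
    (slot a).continuous.measurable
  rw [← (measurePreserving_join n k).lintegral_comp (by fun_prop)]
  simp only [adjoint_diag_join]
  refine (lintegral_mono fun z => mul_le_mul_left (weight_ratio_sq_le α a z) _).trans ?_
  unfold bracketKernel
  rw [Measure.volume_eq_prod, lintegral_prod_symm' _ (by fun_prop)]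
  have h1 : ∀ y : EuclideanSpace ℝ (Fin n) × EuclideanSpace ℝ (Fin n),
      ∫⁻ p : Conf n k, ENNReal.ofReal (9 ^ (α : ℝ)) * bracketKernel α (slot a p) y.1 y.2 *
        f (p + inject a (y.1 + y.2)) =
      ∫⁻ p : Conf n k, ENNReal.ofReal (9 ^ (α : ℝ)) *
        bracketKernel α (slot a p - (y.1 + y.2)) y.1 y.2 * f p := by
    intro y
    rw [← lintegral_sub_right_eq_self _ (inject a (y.1 + y.2))]
    simp [slot_inject]
  refine (lintegral_congr h1).trans_le ?_
  unfold bracketKernel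
  rw [lintegral_lintegral_swap (by fun_prop)]
  have h2 : ∀ p : Conf n k, ∫⁻ y : EuclideanSpace ℝ (Fin n) × EuclideanSpace ℝ (Fin n),
      ENNReal.ofReal (9 ^ (α : ℝ)) * bracketKernel α (slot a p - (y.1 + y.2)) y.1 y.2 * f p =
      restrictConst n α * f p := by
    intro p
    have : Measurable fun y : EuclideanSpace ℝ (Fin n) × EuclideanSpace ℝ (Fin n) =>
        bracketKernel α (slot a p - (y.1 + y.2)) y.1 y.2 := by
      unfold bracketKernel; fun_prop
    rw [lintegral_mul_const _ (by fun_prop), lintegral_const_mul _ this, lintegral_bracketKernel]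
    rfl
  refine (lintegral_congr h2).trans_le ?_
  rw [lintegral_const_mul _ hf]

/-- The Fourier transform of `φ ∘ diag` is the push-forward of that of `φ` along the adjoint
of `diag`. -/
theorem integral_fourier_restrictDiag_mul {n k : ℕ} (a : Fin k ⊕ Fin k)
    (φ : 𝓢(Conf n (k + 1), ℂ)) (g : 𝓢(Conf n k, ℂ)) :
    ∫ p, (𝓕 (restrictDiag n a φ) : 𝓢(Conf n k, ℂ)) p * g p =
      ∫ P, (𝓕 φ : 𝓢(Conf n (k + 1), ℂ)) P * g (ContinuousLinearMap.adjoint (diag n a) P) := by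
  obtain ⟨G, rfl⟩ : ∃ G : 𝓢(Conf n k, ℂ), g = 𝓕⁻ G :=
    ⟨𝓕 g, (FourierTransform.fourierInv_fourier_eq g).symm⟩
  obtain ⟨Φ, rfl⟩ : ∃ Φ : 𝓢(Conf n (k + 1), ℂ), φ = 𝓕⁻ Φ :=
    ⟨𝓕 φ, (FourierTransform.fourierInv_fourier_eq φ).symm⟩
  -- Fubini for the kernel `exp (2πi ⟨diag x, P⟩)`. The minus sign in `L` turns both partial
  -- transforms into inverse Fourier transforms: integrating over `x` evaluates `𝓕⁻ G` at the
  -- adjoint of `P`, integrating over `P` restricts `𝓕⁻ Φ` to the diagonal.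
  have h := VectorFourier.integral_fourierIntegral_smul_eq_flip (μ := volume) (ν := volume)
    (e := Real.fourierChar)
    (L := -((innerₗ (Conf n (k + 1))).comp (diag n a).toLinearMap))
    (f := G) (g := Φ) Real.continuous_fourierChar
    (by
      have : Continuous fun p : Conf n k × Conf n (k + 1) => -inner ℝ (diag n a p.1) p.2 :=
        (Continuous.inner (by fun_prop) (by fun_prop)).neg
      exact this)
    G.integrable Φ.integrable
  have h1 : ∀ P, VectorFourier.fourierIntegral Real.fourierChar volume
      (-((innerₗ (Conf n (k + 1))).comp (diag n a).toLinearMap)) G P =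
      (𝓕⁻ G : 𝓢(Conf n k, ℂ)) (ContinuousLinearMap.adjoint (diag n a) P) := by
    intro P
    rw [SchwartzMap.fourierInv_coe, Real.fourierInv_eq]
    refine integral_congr_ae (Eventually.of_forall fun x => ?_)
    simp [ContinuousLinearMap.adjoint_inner_right]
  have h2 : ∀ x, VectorFourier.fourierIntegral Real.fourierChar volume
      (-((innerₗ (Conf n (k + 1))).comp (diag n a).toLinearMap)).flip Φ x =
      restrictDiag n a (𝓕⁻ Φ) x := by
    intro x
    change _ = (𝓕⁻ Φ : 𝓢(Conf n (k + 1), ℂ)) (diag n a x)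
    rw [SchwartzMap.fourierInv_coe, Real.fourierInv_eq]
    refine integral_congr_ae (Eventually.of_forall fun P => ?_)
    simp [real_inner_comm]
  simp only [h1, h2, smul_eq_mul] at h
  rw [SchwartzMap.integral_fourier_mul_eq, FourierTransform.fourier_fourierInv_eq,
    FourierTransform.fourier_fourierInv_eq]
  simp only [mul_comm (Φ _), h]
  simp only [mul_comm]

/-- The Fourier transform of `S^{(k,α)} φ`. -/
def weightedFourier (n : ℕ) (α : ℝ≥0) (k : ℕ) (φ : 𝓢(Conf n k, ℂ)) : 𝓢(Conf n k, ℂ) :=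
  SchwartzMap.smulLeftCLM ℂ (fun p => (weight n α k p : ℂ)) (𝓕 φ)

theorem weight_complex_hasTemperateGrowth (n : ℕ) (α : ℝ≥0) (k : ℕ) :
    (fun p => (weight n α k p : ℂ)).HasTemperateGrowth :=
  Function.Complex.hasTemperateGrowth_ofReal.comp (weight_hasTemperateGrowth n α k)

theorem weightedFourier_apply (n : ℕ) (α : ℝ≥0) (k : ℕ) (φ : 𝓢(Conf n k, ℂ)) (p : Conf n k) :
    weightedFourier n α k φ p = weight n α k p * (𝓕 φ : 𝓢(Conf n k, ℂ)) p := by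
  rw [weightedFourier, SchwartzMap.smulLeftCLM_apply_apply
    (weight_complex_hasTemperateGrowth n α k), smul_eq_mul]

theorem Sob.S_schwartzToSob (n : ℕ) (α : ℝ≥0) (k : ℕ) (φ : 𝓢(Conf n k, ℂ)) :
    Sob.S (schwartzToSob n α k φ) = 𝓕⁻ ((weightedFourier n α k φ).toLp 2 : L2 n k) := by
  rw [← L2.fourierInv_fourier (Sob.S (schwartzToSob n α k φ))]
  congr 1
  refine Lp.ext ((Sob.fourier_S _).trans ?_)
  have h : (schwartzToSob n α k φ).toL2 = φ.toLp 2 := rfl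
  rw [h, SchwartzMap.toLp_fourier_eq]
  filter_upwards [(𝓕 φ : 𝓢(Conf n k, ℂ)).coeFn_toLp 2,
    (weightedFourier n α k φ).coeFn_toLp 2] with p hp hq
  rw [hp, hq, weightedFourier_apply]

theorem L2.norm_fourierInv {n k : ℕ} (f : L2 n k) : ‖(𝓕⁻ f : L2 n k)‖ = ‖f‖ := by
  rw [← Lp.norm_fourier_eq, L2.fourier_fourierInv]

theorem norm_schwartzToSob (n : ℕ) (α : ℝ≥0) (k : ℕ) (φ : 𝓢(Conf n k, ℂ)) :
    ‖schwartzToSob n α k φ‖ = (eLpNorm (weightedFourier n α k φ) 2).toReal := by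
  rw [Sob.norm_eq, Sob.S_schwartzToSob, L2.norm_fourierInv, SchwartzMap.norm_toLp]

theorem weight_inv_hasTemperateGrowth (n : ℕ) (α : ℝ≥0) (k : ℕ) :
    (fun p => (weight n α k p)⁻¹).HasTemperateGrowth := by
  have h1 : ∀ i : Fin k ⊕ Fin k, (fun p : Conf n k =>
      (1 + ‖(2 * Real.pi) • slot i p‖ ^ 2) ^ (-((α : ℝ) / 2))).HasTemperateGrowth := fun i =>
    (Function.hasTemperateGrowth_one_add_norm_sq_rpow (EuclideanSpace ℝ (Fin n))
      (-((α : ℝ) / 2))).comp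
      (((2 * Real.pi) • slot i : Conf n k →L[ℝ] EuclideanSpace ℝ (Fin n)).hasTemperateGrowth)
  have h2 : ∀ s : Finset (Fin k ⊕ Fin k), (fun p : Conf n k =>
      ∏ i ∈ s, (1 + ‖(2 * Real.pi) • slot i p‖ ^ 2) ^ (-((α : ℝ) / 2))).HasTemperateGrowth := by
    intro s
    induction s using Finset.induction_on with
    | empty => simp
    | insert a s ha ih =>
      simp only [Finset.prod_insert ha]
      exact (h1 a).mul ih
  convert h2 Finset.univ using 2 with p
  rw [weight, ← Finset.prod_inv_distrib]
  exact Finset.prod_congr rfl fun i _ => (Real.rpow_neg (by positivity) _).symm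

/-- The inverse weight also has temperate growth, so dividing by the weight preserves Schwartz
functions. Density of Schwartz kernels in `H^α_k` thereby reduces to density in `L²`. -/
theorem weightedFourier_surjective (n : ℕ) (α : ℝ≥0) (k : ℕ) :
    Function.Surjective (weightedFourier n α k) := by
  intro ψ
  have hinv : (fun p => (((weight n α k p)⁻¹ : ℝ) : ℂ)).HasTemperateGrowth :=
    Function.Complex.hasTemperateGrowth_ofReal.comp (weight_inv_hasTemperateGrowth n α k)
  refine ⟨𝓕⁻ (SchwartzMap.smulLeftCLM ℂ (fun p => (((weight n α k p)⁻¹ : ℝ) : ℂ)) ψ), ?_⟩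
  ext p
  have hne : (weight n α k p : ℂ) ≠ 0 := Complex.ofReal_ne_zero.2 (weight_pos n α k p).ne'
  rw [weightedFourier_apply, FourierTransform.fourier_fourierInv_eq,
    SchwartzMap.smulLeftCLM_apply_apply hinv, smul_eq_mul, Complex.ofReal_inv,
    mul_inv_cancel_left₀ hne]

theorem denseRange_schwartzToSob (n : ℕ) (α : ℝ≥0) (k : ℕ) :
    DenseRange (schwartzToSob n α k) := by
  intro γ
  rw [Metric.mem_closure_range_iff]
  intro ε hε
  obtain ⟨ψ, hψ⟩ := Metric.denseRange_iff.1
    (SchwartzMap.denseRange_toLpCLM (E := Conf n k) (F := ℂ) (p := 2) (μ := volume)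
      ENNReal.ofNat_ne_top) (𝓕 (Sob.S γ)) ε hε
  obtain ⟨φ, rfl⟩ := weightedFourier_surjective n α k ψ
  refine ⟨φ, ?_⟩
  rw [dist_eq_norm] at hψ ⊢
  rw [Sob.norm_eq, map_sub, Sob.S_schwartzToSob, ← Lp.norm_fourier_eq, sub_eq_add_neg,
    FourierTransform.fourier_add, FourierTransform.fourier_neg, L2.fourier_fourierInv,
    ← sub_eq_add_neg]
  exact hψ

theorem lintegral_enorm_sq_eq_eLpNorm_sq {X : Type*} [MeasurableSpace X] {μ : Measure X}
    (f : X → ℂ) : ∫⁻ x, ‖f x‖ₑ ^ 2 ∂μ = eLpNorm f 2 μ ^ 2 := by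
  rw [eLpNorm_eq_lintegral_rpow_enorm_toReal (by norm_num) (by norm_num)]
  simp only [ENNReal.toReal_ofNat, ENNReal.rpow_ofNat, one_div]
  rw [← ENNReal.rpow_natCast, ← ENNReal.rpow_mul]
  norm_num

/-- A duality argument with the function itself as test function, so the unknown norm stands on both
sides. It is finite for Schwartz kernels and can be cancelled afterwards. -/
theorem eLpNorm_weightedFourier_restrictDiag_le (n : ℕ) (α : ℝ≥0) {k : ℕ} (a : Fin k ⊕ Fin k)
    (φ : 𝓢(Conf n (k + 1), ℂ)) :
    eLpNorm (weightedFourier n α k (restrictDiag n a φ)) 2 ^ 2 ≤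
      eLpNorm (weightedFourier n α (k + 1) φ) 2 * (restrictConst n α *
        eLpNorm (weightedFourier n α k (restrictDiag n a φ)) 2 ^ 2) ^ (1 / 2 : ℝ) := by
  set u := weightedFourier n α k (restrictDiag n a φ) with hu
  set v := weightedFourier n α (k + 1) φ with hv
  let A := ContinuousLinearMap.adjoint (diag n a)
  have hA : Measurable A := A.continuous.measurable
  let ρ : Conf n (k + 1) → ℝ≥0∞ := fun P =>
    ENNReal.ofReal (weight n α k (A P) / weight n α (k + 1) P)
  have hρ : Measurable ρ :=
    (((measurable_weight n α k).comp hA).div (measurable_weight n α (k + 1))).ennreal_ofReal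
  -- The test function is the weight times `conj u`: paired with the unweighted transform of the
  -- restriction it gives `∫ |u|²`.
  let g : 𝓢(Conf n k, ℂ) := SchwartzMap.smulLeftCLM ℂ (fun p => (weight n α k p : ℂ))
    (u.postcompCLM (Complex.conjCLE : ℂ →L[ℝ] ℂ))
  have hg : ∀ p, g p = weight n α k p * (starRingEnd ℂ) (u p) := fun p => by
    rw [SchwartzMap.smulLeftCLM_apply_apply (weight_complex_hasTemperateGrowth n α k),
      SchwartzMap.postcompCLM_apply, smul_eq_mul]
    rfl
  have h1 : ∫ p, (𝓕 (restrictDiag n a φ) : 𝓢(Conf n k, ℂ)) p * g p =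
      ((∫ p, ‖u p‖ ^ 2 : ℝ) : ℂ) := by
    rw [← integral_complex_ofReal]
    refine integral_congr_ae (Eventually.of_forall fun p => ?_)
    have := weightedFourier_apply n α k (restrictDiag n a φ) p
    simp only
    rw [hg, mul_left_comm, ← mul_assoc, ← this, ← hu, Complex.mul_conj, Complex.normSq_eq_norm_sq]
  have h2 : ∫⁻ p, ‖u p‖ₑ ^ 2 = ‖∫ p, (𝓕 (restrictDiag n a φ) : 𝓢(Conf n k, ℂ)) p * g p‖ₑ := by
    rw [h1, ← ofReal_norm, Complex.norm_real, Real.norm_of_nonneg (by positivity),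
      ofReal_integral_eq_lintegral_ofReal ?_ (Eventually.of_forall fun _ => by positivity)]
    · refine lintegral_congr fun p => ?_
      rw [ENNReal.ofReal_pow (norm_nonneg _), ofReal_norm]
    · exact (u.memLp 2).integrable_norm_pow (by norm_num)
  rw [← lintegral_enorm_sq_eq_eLpNorm_sq]
  refine (h2.trans (congrArg _ (integral_fourier_restrictDiag_mul a φ g))).trans_le ?_
  refine (enorm_integral_le_lintegral_enorm _).trans ?_
  have h3 : ∀ P, ‖(𝓕 φ : 𝓢(Conf n (k + 1), ℂ)) P * g (A P)‖ₑ =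
      ‖v P‖ₑ * (ρ P * ‖u (A P)‖ₑ) := by
    intro P
    have hw := weight_pos n α (k + 1) P
    have hw' := weight_pos n α k (A P)
    rw [hv, weightedFourier_apply, hg, ← ofReal_norm, ← ofReal_norm, ← ofReal_norm,
      ← ENNReal.ofReal_mul (by positivity), ← ENNReal.ofReal_mul (by positivity)]
    congr 1
    simp only [norm_mul, Complex.norm_real, RCLike.norm_conj, Real.norm_of_nonneg hw.le,
      Real.norm_of_nonneg hw'.le]
    field_simp
  refine (lintegral_congr h3).trans_le ?_
  have hC := ENNReal.lintegral_mul_le_Lp_mul_Lq (volume : Measure (Conf n (k + 1)))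
    Real.HolderConjugate.two_two (f := fun P => ‖v P‖ₑ) (g := fun P => ρ P * ‖u (A P)‖ₑ)
    v.continuous.enorm.measurable.aemeasurable
    (hρ.mul (u.continuous.comp A.continuous).enorm.measurable).aemeasurable
  refine hC.trans (mul_le_mul' (le_of_eq ?_) (ENNReal.rpow_le_rpow ?_ (by norm_num)))
  · rw [eLpNorm_eq_lintegral_rpow_enorm_toReal (by norm_num) (by norm_num)]
    simp
  · have h4 := lintegral_weight_ratio_mul_le α a (f := fun p => ‖u p‖ₑ ^ 2)
      (u.continuous.enorm.measurable.pow_const 2)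
    refine le_trans (le_of_eq (lintegral_congr fun P => ?_)) h4
    have hw := weight_pos n α (k + 1) P
    have hw' := weight_pos n α k (A P)
    rw [ENNReal.rpow_ofNat, mul_pow, ← ENNReal.ofReal_pow (by positivity)]

theorem norm_schwartzToSob_restrictDiag_le {n : ℕ} {α : ℝ≥0} (hα : (n : ℝ) / 2 < α) {k : ℕ}
    (a : Fin k ⊕ Fin k) (φ : 𝓢(Conf n (k + 1), ℂ)) :
    ‖schwartzToSob n α k (restrictDiag n a φ)‖ ≤
      √(restrictConst n α).toReal * ‖schwartzToSob n α (k + 1) φ‖ := by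
  have h := eLpNorm_weightedFourier_restrictDiag_le n α a φ
  have hu := ((weightedFourier n α k (restrictDiag n a φ)).memLp 2).2.ne
  have hv := ((weightedFourier n α (k + 1) φ).memLp 2).2.ne
  have h' := ENNReal.toReal_mono (ENNReal.mul_ne_top hv (ENNReal.rpow_ne_top_of_nonneg
    (by norm_num) (ENNReal.mul_ne_top (restrictConst_ne_top hα) (ENNReal.pow_ne_top hu)))) h
  rw [ENNReal.toReal_pow, ENNReal.toReal_mul, ← ENNReal.toReal_rpow, ENNReal.toReal_mul,
    ENNReal.toReal_pow, ← norm_schwartzToSob, ← norm_schwartzToSob, ← Real.sqrt_eq_rpow,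
    Real.sqrt_mul (by positivity), Real.sqrt_sq (norm_nonneg _)] at h'
  -- Cancels one factor of the norm; if the bound failed, the norm would be positive.
  by_contra! hlt
  have hpos : 0 < ‖schwartzToSob n α k (restrictDiag n a φ)‖ :=
    lt_of_le_of_lt (by positivity) hlt
  nlinarith [mul_lt_mul_of_pos_right hlt hpos]

/-- The operator norm of `B^{(k)}` grows at most linearly in `k`. -/
theorem norm_interaction_apply_le {n : ℕ} {α : ℝ≥0} (hα : (n : ℝ) / 2 < α) (k : ℕ)
    (γ : Sob n α (k + 1)) :
    ‖interaction n α k γ‖ ≤ 2 * √(restrictConst n α).toReal * k * ‖γ‖ := by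
  refine LinearMap.norm_extendOfNorm_apply_le (denseRange_schwartzToSob n α (k + 1)) _
    (fun φ => ?_) γ
  have : schwartzToSob n α k (interactionSchwartz n k φ) =
      ∑ j : Fin k, (schwartzToSob n α k (restrictDiag n (Sum.inl j) φ) -
        schwartzToSob n α k (restrictDiag n (Sum.inr j) φ)) := by
    simp [interactionSchwartz, sum_apply]
  change ‖schwartzToSob n α k (interactionSchwartz n k φ)‖ ≤ _
  rw [this]
  refine (norm_sum_le_of_le _ (f := fun j : Fin k => _) fun j _ => (norm_sub_le _ _).trans
    (add_le_add (norm_schwartzToSob_restrictDiag_le hα (Sum.inl j) φ)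
      (norm_schwartzToSob_restrictDiag_le hα (Sum.inr j) φ))).trans (le_of_eq ?_)
  simp
  ring

/-! ### The free evolution is a strongly continuous family of linear isometries -/

/-- Multiplication by the symbol of the free evolution. -/
def phaseMul {n k : ℕ} (t : ℝ) (f : L2 n k) : L2 n k :=
  (memLp_phase_mul t (Lp.memLp f)).toLp _

theorem coeFn_phaseMul {n k : ℕ} (t : ℝ) (f : L2 n k) :
    phaseMul t f =ᵐ[volume] fun p => phase n k t p * f p := MemLp.coeFn_toLp _

theorem phaseMul_sub {n k : ℕ} (t : ℝ) (f g : L2 n k) :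
    phaseMul t (f - g) = phaseMul t f - phaseMul t g := by
  refine Lp.ext ?_
  filter_upwards [coeFn_phaseMul t f, coeFn_phaseMul t g, coeFn_phaseMul t (f - g),
    Lp.coeFn_sub f g, Lp.coeFn_sub (phaseMul t f) (phaseMul t g)] with p h1 h2 h3 h4 h5
  rw [h3, h4, h5, Pi.sub_apply, Pi.sub_apply, h1, h2, mul_sub]

theorem norm_phaseMul {n k : ℕ} (t : ℝ) (f : L2 n k) : ‖phaseMul t f‖ = ‖f‖ := by
  rw [Lp.norm_def, Lp.norm_def]
  refine congrArg _ (eLpNorm_congr_norm_ae ?_)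
  filter_upwards [coeFn_phaseMul t f] with p hp
  rw [hp, norm_mul, norm_phase, one_mul]

theorem phaseMul_zero {n k : ℕ} (f : L2 n k) : phaseMul 0 f = f := by
  refine Lp.ext ?_
  filter_upwards [coeFn_phaseMul 0 f] with p hp
  rw [hp]
  simp [phase]

theorem continuous_phase_left (n k : ℕ) (p : Conf n k) : Continuous fun t => phase n k t p := by
  unfold phase
  fun_prop

theorem continuous_phaseMul {n k : ℕ} (f : L2 n k) : Continuous fun t => phaseMul t f := by
  refine continuous_iff_continuousAt.2 fun t₀ => ?_
  rw [ContinuousAt, tendsto_iff_norm_sub_tendsto_zero]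
  have hs : ∀ t, ‖phaseMul t f - phaseMul t₀ f‖ =
      √(∫⁻ p, ‖(phase n k t p - phase n k t₀ p) * f p‖ₑ ^ 2).toReal := by
    intro t
    rw [lintegral_enorm_sq_eq_eLpNorm_sq, ENNReal.toReal_pow, Real.sqrt_sq ENNReal.toReal_nonneg,
      Lp.norm_def]
    refine congrArg _ (eLpNorm_congr_ae ?_)
    filter_upwards [coeFn_phaseMul t f, coeFn_phaseMul t₀ f,
      Lp.coeFn_sub (phaseMul t f) (phaseMul t₀ f)] with p h1 h2 h3
    rw [h3, Pi.sub_apply, h1, h2, sub_mul]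
  simp only [hs]
  have hf : ∫⁻ p, ‖f p‖ₑ ^ 2 ≠ ∞ := by
    rw [lintegral_enorm_sq_eq_eLpNorm_sq]
    exact ENNReal.pow_ne_top (Lp.memLp f).2.ne
  have key : Tendsto (fun t => ∫⁻ p, ‖(phase n k t p - phase n k t₀ p) * f p‖ₑ ^ 2) (𝓝 t₀)
      (𝓝 (∫⁻ _ : Conf n k, 0)) := by
    -- The phases are unimodular, so `(2 |f|)²` dominates for every `t`.
    refine tendsto_lintegral_filter_of_dominated_convergence'
      (fun p => (2 * ‖f p‖ₑ) ^ 2) (Eventually.of_forall fun t => ?_)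
      (Eventually.of_forall fun t => Eventually.of_forall fun p => ?_) ?_
      (Eventually.of_forall fun p => ?_)
    · exact ((((continuous_phase n k t).sub (continuous_phase n k t₀)).aestronglyMeasurable.mul
        (Lp.aestronglyMeasurable f)).enorm).pow_const 2
    · rw [enorm_mul]
      gcongr
      rw [← ofReal_norm, show (2 : ℝ≥0∞) = ENNReal.ofReal 2 by simp]
      refine ENNReal.ofReal_le_ofReal ((norm_sub_le _ _).trans ?_)
      rw [norm_phase, norm_phase]
      norm_num
    · simp only [mul_pow]
      rw [lintegral_const_mul' _ _ (by norm_num)]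
      exact ENNReal.mul_ne_top (by norm_num) hf
    · have : Continuous fun t => ‖(phase n k t p - phase n k t₀ p) * f p‖ₑ ^ 2 := by
        have := continuous_phase_left n k p
        exact (ENNReal.continuous_pow 2).comp
          (((this.sub continuous_const).mul continuous_const).enorm)
      simpa using this.tendsto t₀
  rw [lintegral_zero] at key
  have := (Real.continuous_sqrt.tendsto 0).comp
    (by simpa using (ENNReal.tendsto_toReal ENNReal.zero_ne_top).comp key)
  simpa using! this

theorem fourier_S_freeEvolution {n : ℕ} {α : ℝ≥0} {k : ℕ} (t : ℝ) (γ : Sob n α k) :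
    (𝓕 (Sob.S (freeEvolution t γ)) : L2 n k) = phaseMul t (𝓕 (Sob.S γ)) := by
  have h : (𝓕 (freeEvolution t γ).toL2 : L2 n k) = phaseMul t (𝓕 γ.toL2) :=
    L2.fourier_fourierInv _
  refine Lp.ext ?_
  have h1 := Sob.fourier_S (freeEvolution t γ)
  rw [h] at h1
  filter_upwards [h1, Sob.fourier_S γ, coeFn_phaseMul t (𝓕 (Sob.S γ)),
    coeFn_phaseMul t (𝓕 γ.toL2)] with p h1 h2 h3 h4
  rw [h1, h3, h2, h4, mul_left_comm]

theorem Sob.norm_eq_norm_fourier_S {n : ℕ} {α : ℝ≥0} {k : ℕ} (γ : Sob n α k) :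
    ‖γ‖ = ‖(𝓕 (Sob.S γ) : L2 n k)‖ := by
  rw [Sob.norm_eq, Lp.norm_fourier_eq]

theorem L2.fourier_sub {n k : ℕ} (f g : L2 n k) : (𝓕 (f - g) : L2 n k) = 𝓕 f - 𝓕 g :=
  (Lp.fourierTransformₗᵢ (Conf n k) ℂ).map_sub f g

theorem Sob.fourier_S_injective {n : ℕ} {α : ℝ≥0} {k : ℕ} :
    Function.Injective fun γ : Sob n α k => (𝓕 (Sob.S γ) : L2 n k) :=
  (Lp.fourierTransformₗᵢ (Conf n k) ℂ).injective.comp Sob.S_injective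

theorem freeEvolution_sub {n : ℕ} {α : ℝ≥0} {k : ℕ} (t : ℝ) (γ ρ : Sob n α k) :
    freeEvolution t (γ - ρ) = freeEvolution t γ - freeEvolution t ρ := by
  refine Sob.fourier_S_injective ?_
  simp only [fourier_S_freeEvolution, map_sub, L2.fourier_sub, phaseMul_sub]

theorem norm_freeEvolution {n : ℕ} {α : ℝ≥0} {k : ℕ} (t : ℝ) (γ : Sob n α k) :
    ‖freeEvolution t γ‖ = ‖γ‖ := by
  rw [Sob.norm_eq_norm_fourier_S, fourier_S_freeEvolution, norm_phaseMul,
    ← Sob.norm_eq_norm_fourier_S]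

theorem freeEvolution_zero {n : ℕ} {α : ℝ≥0} {k : ℕ} (γ : Sob n α k) :
    freeEvolution 0 γ = γ := by
  refine Sob.fourier_S_injective ?_
  simp only [fourier_S_freeEvolution, phaseMul_zero]

theorem continuous_freeEvolution_left {n : ℕ} {α : ℝ≥0} {k : ℕ} (γ : Sob n α k) :
    Continuous fun t => freeEvolution t γ := by
  refine continuous_iff_continuousAt.2 fun t₀ => ?_
  rw [ContinuousAt, tendsto_iff_norm_sub_tendsto_zero]
  have := tendsto_iff_norm_sub_tendsto_zero.1
    ((continuous_phaseMul (𝓕 (Sob.S γ) : L2 n k)).tendsto t₀)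
  refine this.congr fun t => ?_
  rw [Sob.norm_eq_norm_fourier_S, map_sub, L2.fourier_sub, fourier_S_freeEvolution,
    fourier_S_freeEvolution]

/-- Strong continuity in time upgrades to joint continuity because the evolutions are isometries,
hence equicontinuous. -/
theorem continuous_freeEvolution {n : ℕ} {α : ℝ≥0} {k : ℕ} :
    Continuous fun x : ℝ × Sob n α k => freeEvolution x.1 x.2 := by
  refine continuous_iff_continuousAt.2 fun ⟨t₀, γ₀⟩ => ?_
  rw [ContinuousAt, tendsto_iff_norm_sub_tendsto_zero]
  have h1 : Tendsto (fun x : ℝ × Sob n α k => ‖x.2 - γ₀‖ +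
      ‖freeEvolution x.1 γ₀ - freeEvolution t₀ γ₀‖) (𝓝 (t₀, γ₀)) (𝓝 0) := by
    have : Continuous (fun x : ℝ × Sob n α k => ‖x.2 - γ₀‖ +
        ‖freeEvolution x.1 γ₀ - freeEvolution t₀ γ₀‖) := by
      have := continuous_freeEvolution_left γ₀
      fun_prop
    simpa using this.tendsto (t₀, γ₀)
  refine squeeze_zero (fun _ => norm_nonneg _) (fun x => ?_) h1
  calc ‖freeEvolution x.1 x.2 - freeEvolution t₀ γ₀‖
      = ‖freeEvolution x.1 (x.2 - γ₀) +
          (freeEvolution x.1 γ₀ - freeEvolution t₀ γ₀)‖ := by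
        rw [freeEvolution_sub]; abel_nf
    _ ≤ _ := (norm_add_le _ _).trans_eq (by rw [norm_freeEvolution])

theorem continuousOn_freeEvolution {n : ℕ} {α : ℝ≥0} {k : ℕ} {X : Type*}
    [TopologicalSpace X] {A : Set X} {σ : X → ℝ} {F : X → Sob n α k}
    (hσ : ContinuousOn σ A) (hF : ContinuousOn F A) :
    ContinuousOn (fun x => freeEvolution (σ x) (F x)) A := by
  have h : Continuous fun x : ℝ × Sob n α k => freeEvolution x.1 x.2 := continuous_freeEvolution
  generalize (freeEvolution : ℝ → Sob n α k → Sob n α k) = g at *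
  exact h.comp_continuousOn (hσ.prodMk hF)

/-! ### The Duhamel integrand -/

/-- The constant `C` of the theorem. -/
def hierarchyConst (n : ℕ) (α : ℝ≥0) : ℝ := 2 * √(restrictConst n α).toReal + 1

/-- The summand `1` in the constant secures positivity, which permits division by it. -/
theorem hierarchyConst_pos (n : ℕ) (α : ℝ≥0) : 0 < hierarchyConst n α := by
  unfold hierarchyConst
  positivity

theorem norm_duhamelIntegrand_le {n : ℕ} {α : ℝ≥0} (hα : (n : ℝ) / 2 < α) {μ : ℝ}
    (hμ : |μ| = 1) (Γ : ℝ → Seq n α) (k : ℕ) (t s : ℝ) :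
    ‖duhamelIntegrand μ Γ k t s‖ ≤ hierarchyConst n α * (k + 1) * ‖Γ s (k + 1)‖ := by
  rw [duhamelIntegrand, norm_freeEvolution, norm_smul]
  have : ‖-Complex.I * (μ : ℂ)‖ = 1 := by simp [hμ]
  rw [this, one_mul]
  refine (norm_interaction_apply_le hα (k + 1) _).trans ?_
  -- Entry `k` of a sequence is `γ^{(k+1)}`, so the operator acting is `B^{(k+1)}`: hence the factor
  -- `k + 1`.
  push_cast
  gcongr
  exact le_add_of_nonneg_right zero_le_one

theorem duhamelIntegrand_sub {n : ℕ} {α : ℝ≥0} (μ : ℝ) (Γ Γ' : ℝ → Seq n α) (k : ℕ)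
    (t s : ℝ) : duhamelIntegrand μ (fun s => Γ s - Γ' s) k t s =
      duhamelIntegrand μ Γ k t s - duhamelIntegrand μ Γ' k t s := by
  simp only [duhamelIntegrand, Pi.sub_apply, map_sub, smul_sub, freeEvolution_sub]

theorem continuousOn_freeEvolution_smul_interaction {n : ℕ} {α : ℝ≥0} {k : ℕ}
    {X : Type*} [TopologicalSpace X] {A : Set X} {σ : X → ℝ} {F : X → Sob n α (k + 1)} (c : ℂ)
    (hσ : ContinuousOn σ A) (hF : ContinuousOn F A) :
    ContinuousOn (fun x => freeEvolution (σ x) (c • interaction n α k (F x))) A :=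
  continuousOn_freeEvolution hσ (((interaction n α k).continuous.comp_continuousOn hF).const_smul c)

theorem continuousOn_duhamelIntegrand {n : ℕ} {α : ℝ≥0} (μ : ℝ) {Γ : ℝ → Seq n α} {k : ℕ}
    {A : Set ℝ} (hΓ : ContinuousOn (fun s => Γ s (k + 1)) A) (t : ℝ) :
    ContinuousOn (duhamelIntegrand μ Γ k t) A := by
  have h : ContinuousOn (fun s => t - s) A := by fun_prop
  exact continuousOn_freeEvolution_smul_interaction (-Complex.I * (μ : ℂ)) h hΓ

theorem continuous_duhamelIterate {n : ℕ} {α : ℝ≥0} (μ : ℝ) (Γ₀ : Seq n α) (m k : ℕ) :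
    Continuous fun t => duhamelIterate μ Γ₀ m t k := by
  induction m generalizing k with
  | zero => exact continuous_const
  | succ m ih =>
    refine (continuous_freeEvolution_left _).add ?_
    refine intervalIntegral.continuous_parametric_intervalIntegral_of_continuous
      (f := fun t s => duhamelIntegrand μ (duhamelIterate μ Γ₀ m) k t s) ?_ continuous_id
    rw [← continuousOn_univ]
    have h1 : ContinuousOn (fun x : ℝ × ℝ => x.1 - x.2) Set.univ := by fun_prop
    have h2 : Continuous fun x : ℝ × ℝ => duhamelIterate μ Γ₀ m x.2 (k + 1) :=
      (ih (k + 1)).comp continuous_snd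
    exact continuousOn_freeEvolution_smul_interaction (-Complex.I * (μ : ℂ)) h1 h2.continuousOn

theorem intervalIntegrable_duhamelIntegrand_duhamelIterate {n : ℕ} {α : ℝ≥0} (μ : ℝ)
    (Γ₀ : Seq n α) (m k : ℕ) (t a b : ℝ) :
    IntervalIntegrable (duhamelIntegrand μ (duhamelIterate μ Γ₀ m) k t) volume a b :=
  (continuousOn_duhamelIntegrand μ
    (continuous_duhamelIterate μ Γ₀ m (k + 1)).continuousOn t).intervalIntegrable

/-! ### The majorant of the Duhamel expansion -/

/-- The bound of the `j`-th term of the Duhamel expansion for the entry `k`, where `a` bounds the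
norms of the data and `x` is `C` times the elapsed time. -/
def duhamelBound (x : ℝ) (a : ℕ → ℝ) (k j : ℕ) : ℝ :=
  x ^ j * (k + j).choose k * a (k + j)

theorem duhamelBound_nonneg {x : ℝ} (hx : 0 ≤ x) {a : ℕ → ℝ} (ha : ∀ N, 0 ≤ a N) (k j : ℕ) :
    0 ≤ duhamelBound x a k j :=
  mul_nonneg (by positivity) (ha _)

theorem duhamelBound_mono {x y : ℝ} (hx : 0 ≤ x) (hxy : x ≤ y) {a : ℕ → ℝ} (ha : ∀ N, 0 ≤ a N)
    (k j : ℕ) : duhamelBound x a k j ≤ duhamelBound y a k j := by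
  unfold duhamelBound
  have := ha (k + j)
  gcongr

@[simp]
theorem duhamelBound_zero_right (x : ℝ) (a : ℕ → ℝ) (k : ℕ) : duhamelBound x a k 0 = a k := by
  simp [duhamelBound]

theorem continuous_duhamelBound (C b : ℝ) (a : ℕ → ℝ) (k j : ℕ) :
    Continuous fun s => duhamelBound (C * (s - b)) a k j := by
  unfold duhamelBound
  fun_prop

/-- The majorants reproduce themselves under one Duhamel step, since `(k+1) binom(k+1+j, k+1) =
(j+1) binom(k+1+j, k)` and the time integral supplies `1/(j+1)`. The base time `b` is kept general
for the restart in the uniqueness proof. -/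
theorem integral_duhamelBound (C b t : ℝ) (a : ℕ → ℝ) (k j : ℕ) :
    ∫ s in b..t, C * (k + 1) * duhamelBound (C * (s - b)) a (k + 1) j =
      duhamelBound (C * (t - b)) a k (j + 1) := by
  have h1 : ∀ s, C * (k + 1) * duhamelBound (C * (s - b)) a (k + 1) j =
      (C ^ (j + 1) * (k + 1) * (k + 1 + j).choose (k + 1) * a (k + 1 + j)) * (s - b) ^ j := by
    intro s
    rw [duhamelBound, mul_pow]
    ring
  simp only [h1]
  rw [intervalIntegral.integral_const_mul, intervalIntegral.integral_comp_sub_right (· ^ j),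
    integral_pow, duhamelBound, show k + (j + 1) = k + 1 + j by ring]
  have h2 : ((k + 1 + j).choose (k + 1) : ℝ) * (k + 1) = (k + 1 + j).choose k * (j + 1) := by
    have := Nat.choose_succ_right_eq (k + 1 + j) k
    rw [show k + 1 + j - k = j + 1 by omega] at this
    exact_mod_cast this
  have hj : (j + 1 : ℝ) ≠ 0 := by positivity
  rw [sub_self, zero_pow (Nat.succ_ne_zero j), sub_zero, mul_pow]
  field_simp
  linear_combination (C ^ (j + 1) * a (k + 1 + j) * (t - b) ^ (j + 1)) * h2

theorem hasSum_duhamelBound {η x : ℝ} (hη : 0 < η) (hx : 0 ≤ x) {a : ℕ → ℝ}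
    (ha : ∀ N, 0 ≤ a N) (hs : Summable fun N => (η + x) ^ (N + 1) * a N) :
    HasSum (fun kj : ℕ × ℕ => η ^ (kj.1 + 1) * duhamelBound x a kj.1 kj.2)
      (η / (η + x) * ∑' N, (η + x) ^ (N + 1) * a N) := by
  rw [← Equiv.hasSum_iff Finset.HasAntidiagonal.sigmaAntidiagonalEquivProd]
  have hpos : 0 < η + x := by positivity
  have hin : ∀ N, HasSum (fun c : Finset.HasAntidiagonal.antidiagonal N =>
      ((fun kj : ℕ × ℕ => η ^ (kj.1 + 1) * duhamelBound x a kj.1 kj.2) ∘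
        Finset.HasAntidiagonal.sigmaAntidiagonalEquivProd) ⟨N, c⟩)
      (η / (η + x) * ((η + x) ^ (N + 1) * a N)) := by
    intro N
    have h := Finset.hasSum (Finset.HasAntidiagonal.antidiagonal N)
      (fun kj : ℕ × ℕ => η ^ (kj.1 + 1) * duhamelBound x a kj.1 kj.2)
    have h2 : ∑ kj ∈ Finset.HasAntidiagonal.antidiagonal N, η ^ (kj.1 + 1) * duhamelBound x a kj.1 kj.2 =
        η / (η + x) * ((η + x) ^ (N + 1) * a N) := by
      -- On the antidiagonal `k + j = N` the data factor `a N` is constant, and the rest is the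
      -- binomial expansion of `(η + x)^N`.
      rw [show η / (η + x) * ((η + x) ^ (N + 1) * a N) = η * a N * (η + x) ^ N by
        field_simp; ring, (Commute.all η x).add_pow', Finset.mul_sum]
      refine Finset.sum_congr rfl fun kj hkj => ?_
      rw [Finset.HasAntidiagonal.mem_antidiagonal] at hkj
      rw [duhamelBound, hkj, nsmul_eq_mul]
      ring
    rw [h2] at h
    exact h
  refine HasSum.sigma_of_hasSum (hs.hasSum.mul_left _) hin ?_
  rw [summable_sigma_of_nonneg]
  · refine ⟨fun N => (hin N).summable, ?_⟩
    simp only [fun N => (hin N).tsum_eq]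
    exact hs.mul_left _
  · rintro ⟨N, c⟩
    exact mul_nonneg (by positivity) (duhamelBound_nonneg hx ha _ _)

/-! ### Estimates for Duhamel terms -/

theorem norm_integral_duhamelIntegrand_le {n : ℕ} {α : ℝ≥0} (hα : (n : ℝ) / 2 < α) {μ : ℝ}
    (hμ : |μ| = 1) {Γ : ℝ → Seq n α} {k : ℕ} {b t : ℝ} (hbt : b ≤ t) (r : ℝ) {g : ℝ → ℝ}
    (hg : Continuous g) (h : ∀ s ∈ Icc b t, ‖Γ s (k + 1)‖ ≤ g s) :
    ‖∫ s in b..t, duhamelIntegrand μ Γ k r s‖ ≤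
      ∫ s in b..t, hierarchyConst n α * (k + 1) * g s := by
  refine intervalIntegral.norm_integral_le_of_norm_le hbt
    (Eventually.of_forall fun s hs => (norm_duhamelIntegrand_le hα hμ Γ k r s).trans ?_)
    (Continuous.intervalIntegrable (by fun_prop) _ _)
  have := hierarchyConst_pos n α
  gcongr
  exact h s (Ioc_subset_Icc_self hs)

/-- The common induction step: each majorant rises by one order. Data and order vary with `i` so
that main terms and remainders are treated together. -/
theorem norm_integral_duhamelIntegrand_le_sum {n : ℕ} {α : ℝ≥0} (hα : (n : ℝ) / 2 < α) {μ : ℝ}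
    (hμ : |μ| = 1) {Γ : ℝ → Seq n α} {k : ℕ} {b t : ℝ} (hbt : b ≤ t) (r : ℝ)
    {ι : Type*} (S : Finset ι) (a : ι → ℕ → ℝ) (e : ι → ℕ)
    (h : ∀ s ∈ Icc b t, ‖Γ s (k + 1)‖ ≤
      ∑ i ∈ S, duhamelBound (hierarchyConst n α * (s - b)) (a i) (k + 1) (e i)) :
    ‖∫ s in b..t, duhamelIntegrand μ Γ k r s‖ ≤
      ∑ i ∈ S, duhamelBound (hierarchyConst n α * (t - b)) (a i) k (e i + 1) := by
  have hc : ∀ i, Continuous fun s =>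
      duhamelBound (hierarchyConst n α * (s - b)) (a i) (k + 1) (e i) :=
    fun i => continuous_duhamelBound _ _ _ _ _
  refine (norm_integral_duhamelIntegrand_le hα hμ hbt r (by fun_prop) h).trans (le_of_eq ?_)
  simp only [Finset.mul_sum]
  rw [intervalIntegral.integral_finsetSum fun i _ =>
    Continuous.intervalIntegrable (by fun_prop) _ _]
  exact Finset.sum_congr rfl fun i _ => integral_duhamelBound _ _ _ _ _ _

theorem norm_duhamelIterate_le {n : ℕ} {α : ℝ≥0} (hα : (n : ℝ) / 2 < α) {μ : ℝ}
    (hμ : |μ| = 1) (Γ₀ : Seq n α) (m k : ℕ) {t : ℝ} (ht : 0 ≤ t) :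
    ‖duhamelIterate μ Γ₀ m t k‖ ≤
      ∑ j ∈ Finset.range (m + 1),
        duhamelBound (hierarchyConst n α * t) (fun N => ‖Γ₀ N‖) k j := by
  induction m generalizing k t with
  | zero => simp [duhamelIterate]
  | succ m ih =>
    rw [Finset.sum_range_succ', duhamelBound_zero_right, add_comm _ ‖Γ₀ k‖]
    refine (norm_add_le _ _).trans (add_le_add (norm_freeEvolution _ _).le ?_)
    have := norm_integral_duhamelIntegrand_le_sum hα hμ (Γ := duhamelIterate μ Γ₀ m) (k := k)
      ht t (Finset.range (m + 1)) (fun _ N => ‖Γ₀ N‖) id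
      (fun s hs => by simpa using ih (k + 1) hs.1)
    simpa using this

/-- The recursion is affine, so the increment is the first one after `m` Duhamel steps. The
iteration starts from the constant `Γ₀`, not from its free evolution; therefore `U(t)Γ₀ - Γ₀` enters
the first increment and accounts for the factor `2`. -/
theorem norm_duhamelIterate_succ_sub_le {n : ℕ} {α : ℝ≥0} (hα : (n : ℝ) / 2 < α) {μ : ℝ}
    (hμ : |μ| = 1) (Γ₀ : Seq n α) (m k : ℕ) {t : ℝ} (ht : 0 ≤ t) :
    ‖duhamelIterate μ Γ₀ (m + 1) t k - duhamelIterate μ Γ₀ m t k‖ ≤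
      duhamelBound (hierarchyConst n α * t) (fun N => 2 * ‖Γ₀ N‖) k m +
        duhamelBound (hierarchyConst n α * t) (fun N => ‖Γ₀ N‖) k (m + 1) := by
  induction m generalizing k t with
  | zero =>
    have := norm_integral_duhamelIntegrand_le_sum hα hμ (Γ := duhamelIterate μ Γ₀ 0) (k := k)
      ht t {0} (fun _ N => ‖Γ₀ N‖) id (fun s _ => by simp [duhamelIterate])
    simp only [Finset.sum_singleton, id, sub_zero] at this
    calc _ = ‖(freeEvolution t (Γ₀ k) +
          ∫ s in (0 : ℝ)..t, duhamelIntegrand μ (duhamelIterate μ Γ₀ 0) k t s) - Γ₀ k‖ := rfl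
      _ ≤ (‖freeEvolution t (Γ₀ k)‖ + _) + ‖Γ₀ k‖ :=
        (norm_sub_le _ _).trans (add_le_add_left (norm_add_le _ _) _)
      _ ≤ _ := by
        rw [norm_freeEvolution, duhamelBound_zero_right]
        linarith
  | succ m ih =>
    have h1 : duhamelIterate μ Γ₀ (m + 1 + 1) t k - duhamelIterate μ Γ₀ (m + 1) t k =
        ∫ s in (0 : ℝ)..t, duhamelIntegrand μ
          (fun s => duhamelIterate μ Γ₀ (m + 1) s - duhamelIterate μ Γ₀ m s) k t s := by
      simp only [duhamelIntegrand_sub]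
      rw [intervalIntegral.integral_sub
        (intervalIntegrable_duhamelIntegrand_duhamelIterate μ Γ₀ (m + 1) k t 0 t)
        (intervalIntegrable_duhamelIntegrand_duhamelIterate μ Γ₀ m k t 0 t)]
      exact add_sub_add_left_eq_sub _ _ _
    rw [h1]
    have := norm_integral_duhamelIntegrand_le_sum hα hμ
      (Γ := fun s => duhamelIterate μ Γ₀ (m + 1) s - duhamelIterate μ Γ₀ m s) (k := k)
      ht t Finset.univ (fun i : Bool => if i then fun N => 2 * ‖Γ₀ N‖ else fun N => ‖Γ₀ N‖)
      (fun i => if i then m else m + 1)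
      (fun s hs => by simpa using ih (k + 1) hs.1)
    simpa using this

theorem norm_le_sum_duhamelBound_add {n : ℕ} {α : ℝ≥0} (hα : (n : ℝ) / 2 < α) {μ : ℝ}
    (hμ : |μ| = 1) {Γ : ℝ → Seq n α} {b T : ℝ} {a M : ℕ → ℝ}
    (hΓ : ∀ k, ∀ t ∈ Icc b T,
      ‖Γ t k‖ ≤ a k + ‖∫ s in b..t, duhamelIntegrand μ Γ k t s‖)
    (hM : ∀ k, ∀ t ∈ Icc b T, ‖Γ t k‖ ≤ M k) (m k : ℕ) {t : ℝ} (ht : t ∈ Icc b T) :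
    ‖Γ t k‖ ≤ ∑ j ∈ Finset.range m, duhamelBound (hierarchyConst n α * (t - b)) a k j +
      duhamelBound (hierarchyConst n α * (t - b)) M k m := by
  induction m generalizing k t with
  | zero => simpa using hM k t ht
  | succ m ih =>
    refine (hΓ k t ht).trans ?_
    rw [Finset.sum_range_succ', duhamelBound_zero_right]
    have := norm_integral_duhamelIntegrand_le_sum hα hμ (Γ := Γ) (k := k) ht.1 t
      -- The top order carries the a priori bound `M`; the lower orders carry the data `a`.
      (Finset.range (m + 1)) (fun j => if j = m then M else a) id
      (fun s hs => by
        refine (ih (k + 1) ⟨hs.1, hs.2.trans ht.2⟩).trans (le_of_eq ?_)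
        rw [Finset.sum_range_succ]
        congr 1
        · exact Finset.sum_congr rfl fun j hj => by
            rw [if_neg (Finset.mem_range.1 hj).ne, id]
        · simp)
    rw [Finset.sum_range_succ] at this
    simp only [if_true, id] at this
    rw [Finset.sum_congr rfl fun j hj => by
      rw [if_neg (Finset.mem_range.1 hj).ne]] at this
    linarith

/-! ### The weighted norms -/

theorem HSpace.sub_mem {n : ℕ} {α : ℝ≥0} {ξ : ℝ} (hξ : 0 ≤ ξ) {Γ Γ' : Seq n α}
    (h : Γ ∈ HSpace n α ξ) (h' : Γ' ∈ HSpace n α ξ) : Γ - Γ' ∈ HSpace n α ξ := by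
  refine Summable.of_nonneg_of_le (fun k => by positivity) (fun k => ?_) (Summable.add h h')
  rw [← mul_add]
  exact mul_le_mul_of_nonneg_left (norm_sub_le _ _) (by positivity)

theorem HSpace.mem_of_norm_le {n : ℕ} {α : ℝ≥0} {ξ : ℝ} (hξ : 0 ≤ ξ) {Γ : Seq n α} {b : ℕ → ℝ}
    (hb : Summable fun k => ξ ^ (k + 1) * b k) (h : ∀ k, ‖Γ k‖ ≤ b k) : Γ ∈ HSpace n α ξ :=
  Summable.of_nonneg_of_le (fun k => by positivity)
    (fun k => mul_le_mul_of_nonneg_left (h k) (by positivity)) hb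

theorem hnorm_le_of_norm_le {n : ℕ} {α : ℝ≥0} {ξ : ℝ} (hξ : 0 ≤ ξ) {Γ : Seq n α} {b : ℕ → ℝ}
    (hb : Summable fun k => ξ ^ (k + 1) * b k) (h : ∀ k, ‖Γ k‖ ≤ b k) :
    hnorm ξ Γ ≤ ∑' k, ξ ^ (k + 1) * b k :=
  Summable.tsum_le_tsum (fun k => mul_le_mul_of_nonneg_left (h k) (by positivity))
    (HSpace.mem_of_norm_le hξ hb h) hb

theorem hnorm_le_hnorm_add_hnorm_sub {n : ℕ} {α : ℝ≥0} {ξ : ℝ} (hξ : 0 ≤ ξ) {Γ Γ' : Seq n α}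
    (h : Γ ∈ HSpace n α ξ) (h' : Γ' ∈ HSpace n α ξ) :
    hnorm ξ Γ ≤ hnorm ξ Γ' + hnorm ξ (Γ - Γ') := by
  have hs : Summable fun k => ξ ^ (k + 1) * ‖(Γ - Γ') k‖ := HSpace.sub_mem hξ h h'
  rw [hnorm, hnorm, hnorm, ← Summable.tsum_add h' hs]
  refine Summable.tsum_le_tsum (fun k => ?_) h (Summable.add h' hs)
  rw [← mul_add]
  exact mul_le_mul_of_nonneg_left (norm_le_norm_add_norm_sub' _ _) (by positivity)

theorem hnorm_sub_comm {n : ℕ} {α : ℝ≥0} (ξ : ℝ) (Γ Γ' : Seq n α) :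
    hnorm ξ (Γ - Γ') = hnorm ξ (Γ' - Γ) := by
  simp only [hnorm, Pi.sub_apply, norm_sub_rev]

theorem norm_le_hnorm_div {n : ℕ} {α : ℝ≥0} {ξ : ℝ} (hξ : 0 < ξ) {Γ : Seq n α}
    (h : Γ ∈ HSpace n α ξ) (k : ℕ) : ‖Γ k‖ ≤ hnorm ξ Γ / ξ ^ (k + 1) := by
  rw [le_div_iff₀ (by positivity), mul_comm]
  exact Summable.le_tsum (f := fun k => ξ ^ (k + 1) * ‖Γ k‖) h k fun _ _ => by positivity

/-- Dominated convergence for series: a summable majorant uniform in `t` turns entrywise continuity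
into continuity in the weighted norm. -/
theorem MemC.of_norm_le {n : ℕ} {α : ℝ≥0} {T ξ : ℝ} (hξ : 0 ≤ ξ) {Γ : ℝ → Seq n α}
    (hc : ∀ k, ContinuousOn (fun t => Γ t k) (Icc 0 T)) {b : ℕ → ℝ}
    (hb : Summable fun k => ξ ^ (k + 1) * b k) (h : ∀ t ∈ Icc 0 T, ∀ k, ‖Γ t k‖ ≤ b k) :
    MemC T ξ Γ where
  mem t ht := HSpace.mem_of_norm_le hξ hb (h t ht)
  cont t₀ ht₀ := by
    have key : Tendsto (fun t => ∑' k, ξ ^ (k + 1) * ‖(Γ t - Γ t₀) k‖) (𝓝[Icc 0 T] t₀)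
        (𝓝 (∑' _ : ℕ, (0 : ℝ))) := by
      refine tendsto_tsum_of_dominated_convergence (hb.mul_left 2) (fun k => ?_) ?_
      · have := tendsto_iff_norm_sub_tendsto_zero.1 (hc k t₀ ht₀)
        simpa using this.const_mul (ξ ^ (k + 1))
      · filter_upwards [self_mem_nhdsWithin] with t ht k
        rw [Real.norm_of_nonneg (by positivity), mul_left_comm]
        refine mul_le_mul_of_nonneg_left ((norm_sub_le _ _).trans ?_) (by positivity)
        linarith [h t ht k, h t₀ ht₀ k]
    simpa [hnorm] using key

theorem MemC.exists_hnorm_le {n : ℕ} {α : ℝ≥0} {T ξ : ℝ} (hξ : 0 ≤ ξ) {Γ : ℝ → Seq n α}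
    (h : MemC T ξ Γ) : ∃ M, ∀ t ∈ Icc 0 T, hnorm ξ (Γ t) ≤ M := by
  have hc : ContinuousOn (fun t => hnorm ξ (Γ t)) (Icc 0 T) := by
    intro t₀ ht₀
    rw [ContinuousWithinAt, tendsto_iff_norm_sub_tendsto_zero]
    refine squeeze_zero' (Eventually.of_forall fun _ => norm_nonneg _) ?_ (h.cont t₀ ht₀)
    filter_upwards [self_mem_nhdsWithin] with t ht
    rw [Real.norm_eq_abs, abs_le]
    have h1 := hnorm_le_hnorm_add_hnorm_sub hξ (h.mem t ht) (h.mem t₀ ht₀)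
    have h2 := hnorm_le_hnorm_add_hnorm_sub hξ (h.mem t₀ ht₀) (h.mem t ht)
    rw [hnorm_sub_comm] at h2
    constructor <;> linarith
  obtain ⟨M, hM⟩ := isCompact_Icc.exists_bound_of_continuousOn hc
  exact ⟨M, fun t ht => (le_abs_self _).trans (hM t ht)⟩

/-! ### Existence -/

theorem summable_of_summable_weighted {η : ℝ} (hη : 0 < η) {B : ℕ → ℕ → ℝ}
    (h : Summable fun kj : ℕ × ℕ => η ^ (kj.1 + 1) * B kj.1 kj.2) (k : ℕ) :
    Summable (B k) :=
  (summable_mul_left_iff (pow_pos hη (k + 1)).ne').1 (h.prod_factor k)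

theorem summable_weighted_tsum {η : ℝ} {B : ℕ → ℕ → ℝ}
    (h : Summable fun kj : ℕ × ℕ => η ^ (kj.1 + 1) * B kj.1 kj.2) :
    Summable fun k => η ^ (k + 1) * ∑' j, B k j := by
  simpa only [tsum_mul_left] using h.prod

theorem tsum_weighted_tsum {η : ℝ} {B : ℕ → ℕ → ℝ}
    (h : Summable fun kj : ℕ × ℕ => η ^ (kj.1 + 1) * B kj.1 kj.2) :
    ∑' k, η ^ (k + 1) * ∑' j, B k j = ∑' kj : ℕ × ℕ, η ^ (kj.1 + 1) * B kj.1 kj.2 := by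
  simpa only [tsum_mul_left] using h.tsum_prod.symm

/-- A bound for the increments of the iterated Duhamel expansion. -/
def incrementBound (x : ℝ) (a : ℕ → ℝ) (k m : ℕ) : ℝ :=
  duhamelBound x (fun N => 2 * a N) k m + duhamelBound x a k (m + 1)

theorem summable_incrementBound {η x : ℝ} (hη : 0 < η) (hx : 0 ≤ x) {a : ℕ → ℝ}
    (ha : ∀ N, 0 ≤ a N) (hs : Summable fun N => (η + x) ^ (N + 1) * a N) :
    Summable fun kj : ℕ × ℕ => η ^ (kj.1 + 1) * incrementBound x a kj.1 kj.2 := by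
  have h1 : Summable fun N => (η + x) ^ (N + 1) * (2 * a N) := by
    simpa only [mul_left_comm] using hs.mul_left 2
  have h2 := (hasSum_duhamelBound hη hx (fun N => mul_nonneg zero_le_two (ha N)) h1).summable
  have h3 := (hasSum_duhamelBound hη hx ha hs).summable.comp_injective
    (i := fun kj : ℕ × ℕ => (kj.1, kj.2 + 1)) (by
      rintro ⟨k, j⟩ ⟨k', j'⟩ h
      simpa using h)
  simpa only [incrementBound, mul_add, Function.comp_apply] using h2.add h3

theorem incrementBound_mono {x y : ℝ} (hx : 0 ≤ x) (hxy : x ≤ y) {a : ℕ → ℝ}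
    (ha : ∀ N, 0 ≤ a N) (k m : ℕ) : incrementBound x a k m ≤ incrementBound y a k m :=
  add_le_add (duhamelBound_mono hx hxy (fun N => mul_nonneg zero_le_two (ha N)) k m)
    (duhamelBound_mono hx hxy ha k (m + 1))

/-- The limit of the iterated Duhamel expansion. -/
def duhamelLimit {n : ℕ} {α : ℝ≥0} (μ : ℝ) (Γ₀ : Seq n α) (t : ℝ) : Seq n α := fun k =>
  Γ₀ k + ∑' m, (duhamelIterate μ Γ₀ (m + 1) t k - duhamelIterate μ Γ₀ m t k)

theorem duhamelIterate_zero_right {n : ℕ} {α : ℝ≥0} (μ : ℝ) (Γ₀ : Seq n α) (m : ℕ) :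
    duhamelIterate μ Γ₀ m 0 = Γ₀ := by
  cases m with
  | zero => rfl
  | succ m =>
    funext k
    simp [duhamelIterate, freeEvolution_zero]

theorem duhamelLimit_zero_right {n : ℕ} {α : ℝ≥0} (μ : ℝ) (Γ₀ : Seq n α) :
    duhamelLimit μ Γ₀ 0 = Γ₀ := by
  funext k
  simp [duhamelLimit, duhamelIterate_zero_right]

theorem norm_duhamelIterate_succ_sub_le_incrementBound {n : ℕ} {α : ℝ≥0}
    (hα : (n : ℝ) / 2 < α) {μ : ℝ} (hμ : |μ| = 1) (Γ₀ : Seq n α) {T t : ℝ} (ht : t ∈ Icc 0 T)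
    (m k : ℕ) :
    ‖duhamelIterate μ Γ₀ (m + 1) t k - duhamelIterate μ Γ₀ m t k‖ ≤
      incrementBound (hierarchyConst n α * T) (fun N => ‖Γ₀ N‖) k m := by
  have hC := hierarchyConst_pos n α
  exact (norm_duhamelIterate_succ_sub_le hα hμ Γ₀ m k ht.1).trans
    (incrementBound_mono (mul_nonneg hC.le ht.1) (mul_le_mul_of_nonneg_left ht.2 hC.le)
      (fun _ => norm_nonneg _) k m)

theorem norm_duhamelIterate_sub_duhamelLimit_le {n : ℕ} {α : ℝ≥0} (hα : (n : ℝ) / 2 < α)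
    {μ : ℝ} (hμ : |μ| = 1) (Γ₀ : Seq n α) {T t : ℝ} (ht : t ∈ Icc 0 T) {k : ℕ}
    (hs : Summable (incrementBound (hierarchyConst n α * T) (fun N => ‖Γ₀ N‖) k)) (M : ℕ) :
    ‖duhamelIterate μ Γ₀ M t k - duhamelLimit μ Γ₀ t k‖ ≤
      ∑' j, incrementBound (hierarchyConst n α * T) (fun N => ‖Γ₀ N‖) k (j + M) := by
  have hd := fun m => norm_duhamelIterate_succ_sub_le_incrementBound hα hμ Γ₀ ht m k
  have h1 : duhamelIterate μ Γ₀ M t k = Γ₀ k + ∑ m ∈ Finset.range M,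
      (duhamelIterate μ Γ₀ (m + 1) t k - duhamelIterate μ Γ₀ m t k) := by
    rw [Finset.sum_range_sub (fun m => duhamelIterate μ Γ₀ m t k)]
    exact (add_sub_cancel _ _).symm
  have h2 := (Summable.of_norm_bounded hs hd).sum_add_tsum_nat_add M
  rw [h1, duhamelLimit, ← h2, ← add_assoc, sub_add_cancel_left, norm_neg]
  exact tsum_of_norm_bounded ((summable_nat_add_iff M).2 hs).hasSum fun m => hd (m + M)

theorem continuousOn_duhamelLimit {n : ℕ} {α : ℝ≥0} (hα : (n : ℝ) / 2 < α)
    {μ : ℝ} (hμ : |μ| = 1) (Γ₀ : Seq n α) {T : ℝ} {k : ℕ}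
    (hs : Summable (incrementBound (hierarchyConst n α * T) (fun N => ‖Γ₀ N‖) k)) :
    ContinuousOn (fun t => duhamelLimit μ Γ₀ t k) (Icc 0 T) :=
  continuousOn_const.add (continuousOn_tsum
    (fun m => ((continuous_duhamelIterate μ Γ₀ (m + 1) k).sub
      (continuous_duhamelIterate μ Γ₀ m k)).continuousOn) hs
    fun m _ ht => norm_duhamelIterate_succ_sub_le_incrementBound hα hμ Γ₀ ht m k)

theorem tendsto_duhamelIterate {n : ℕ} {α : ℝ≥0} (hα : (n : ℝ) / 2 < α)
    {μ : ℝ} (hμ : |μ| = 1) (Γ₀ : Seq n α) {T t : ℝ} (ht : t ∈ Icc 0 T) {k : ℕ}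
    (hs : Summable (incrementBound (hierarchyConst n α * T) (fun N => ‖Γ₀ N‖) k)) :
    Tendsto (fun m => duhamelIterate μ Γ₀ m t k) atTop (𝓝 (duhamelLimit μ Γ₀ t k)) :=
  tendsto_iff_norm_sub_tendsto_zero.2 (squeeze_zero (fun _ => norm_nonneg _)
    (norm_duhamelIterate_sub_duhamelLimit_le hα hμ Γ₀ ht hs) (tendsto_sum_nat_add _))

theorem tendsto_integral_duhamelIntegrand_duhamelIterate {n : ℕ} {α : ℝ≥0}
    (hα : (n : ℝ) / 2 < α) {μ : ℝ} (hμ : |μ| = 1) (Γ₀ : Seq n α) {T t : ℝ} (ht : t ∈ Icc 0 T)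
    {k : ℕ}
    (hs : Summable (incrementBound (hierarchyConst n α * T) (fun N => ‖Γ₀ N‖) (k + 1)))
    (hi : IntervalIntegrable (duhamelIntegrand μ (duhamelLimit μ Γ₀) k t) volume 0 t) :
    Tendsto (fun m => ∫ s in (0 : ℝ)..t, duhamelIntegrand μ (duhamelIterate μ Γ₀ m) k t s) atTop
      (𝓝 (∫ s in (0 : ℝ)..t, duhamelIntegrand μ (duhamelLimit μ Γ₀) k t s)) := by
  have hC := hierarchyConst_pos n α
  have h0 : Tendsto (fun M => hierarchyConst n α * (k + 1) * (∑' j, incrementBound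
      (hierarchyConst n α * T) (fun N => ‖Γ₀ N‖) (k + 1) (j + M)) * |t - 0|) atTop (𝓝 0) := by
    simpa using ((tendsto_sum_nat_add _).const_mul (hierarchyConst n α * (k + 1))).mul_const |t - 0|
  refine tendsto_iff_norm_sub_tendsto_zero.2 (squeeze_zero (fun _ => norm_nonneg _)
    (fun M => ?_) h0)
  rw [← intervalIntegral.integral_sub
    (intervalIntegrable_duhamelIntegrand_duhamelIterate μ Γ₀ M k t 0 t) hi]
  simp only [← duhamelIntegrand_sub]
  refine intervalIntegral.norm_integral_le_of_norm_le_const fun s hs' => ?_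
  rw [uIoc_of_le ht.1] at hs'
  refine (norm_duhamelIntegrand_le hα hμ _ k t s).trans
    (mul_le_mul_of_nonneg_left ?_ (by positivity))
  exact norm_duhamelIterate_sub_duhamelLimit_le hα hμ Γ₀
    ⟨hs'.1.le, hs'.2.trans ht.2⟩ hs M

theorem norm_duhamelIterate_le_tsum {n : ℕ} {α : ℝ≥0} (hα : (n : ℝ) / 2 < α)
    {μ : ℝ} (hμ : |μ| = 1) (Γ₀ : Seq n α) {T t : ℝ} (ht : t ∈ Icc 0 T) (m : ℕ) {k : ℕ}
    (hs : Summable (duhamelBound (hierarchyConst n α * T) (fun N => ‖Γ₀ N‖) k)) :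
    ‖duhamelIterate μ Γ₀ m t k‖ ≤
      ∑' j, duhamelBound (hierarchyConst n α * T) (fun N => ‖Γ₀ N‖) k j := by
  have hC := hierarchyConst_pos n α
  refine (norm_duhamelIterate_le hα hμ Γ₀ m k ht.1).trans
    ((Finset.sum_le_sum fun j _ => ?_).trans (hs.sum_le_tsum _ fun j _ => ?_))
  · exact duhamelBound_mono (mul_nonneg hC.le ht.1) (mul_le_mul_of_nonneg_left ht.2 hC.le)
      (fun _ => norm_nonneg _) k j
  · exact duhamelBound_nonneg (mul_nonneg hC.le (ht.1.trans ht.2)) (fun _ => norm_nonneg _) k j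

theorem exists_isMildSolution {n : ℕ} {α : ℝ≥0} (hα : (n : ℝ) / 2 < α) {μ : ℝ} (hμ : |μ| = 1)
    {ξ η T : ℝ} (hη : 0 < η) (hT : 0 ≤ T) (hξ : η + hierarchyConst n α * T = ξ) {Γ₀ : Seq n α}
    (hΓ₀ : Γ₀ ∈ HSpace n α ξ) :
    ∃ Γ : ℝ → Seq n α, IsMildSolution μ T η Γ ∧ Γ 0 = Γ₀ ∧
      (∀ t ∈ Icc 0 T, hnorm η (Γ t) ≤ η / ξ * hnorm ξ Γ₀) ∧
      (∀ m, MemC T η (duhamelIterate μ Γ₀ m)) ∧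
      ∀ ε : ℝ, 0 < ε → ∃ M : ℕ, ∀ m ≥ M, ∀ t ∈ Icc 0 T,
        hnorm η (duhamelIterate μ Γ₀ m t - Γ t) ≤ ε := by
  have hx : 0 ≤ hierarchyConst n α * T := mul_nonneg (hierarchyConst_pos n α).le hT
  have ha : ∀ N, 0 ≤ ‖Γ₀ N‖ := fun _ => norm_nonneg _
  have hsa : Summable fun N => (η + hierarchyConst n α * T) ^ (N + 1) * ‖Γ₀ N‖ := by
    rw [hξ]; exact hΓ₀
  have hB := hasSum_duhamelBound hη hx ha hsa
  have hI := summable_incrementBound hη hx ha hsa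
  have hIk := summable_of_summable_weighted (B := incrementBound _ _) hη hI
  have hBk := summable_of_summable_weighted (B := duhamelBound _ _) hη hB.summable
  have hBs := summable_weighted_tsum (B := duhamelBound _ _) hB.summable
  have hle : ∀ t ∈ Icc 0 T, ∀ k, ‖duhamelLimit μ Γ₀ t k‖ ≤
      ∑' j, duhamelBound (hierarchyConst n α * T) (fun N => ‖Γ₀ N‖) k j := fun t ht k =>
    le_of_tendsto (tendsto_duhamelIterate hα hμ Γ₀ ht (hIk k)).norm
      (Eventually.of_forall fun m => norm_duhamelIterate_le_tsum hα hμ Γ₀ ht m (hBk k))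
  have hint : ∀ k, ∀ t ∈ Icc 0 T,
      IntervalIntegrable (duhamelIntegrand μ (duhamelLimit μ Γ₀) k t) volume 0 t := by
    intro k t ht
    refine ContinuousOn.intervalIntegrable (continuousOn_duhamelIntegrand μ ?_ t)
    rw [uIcc_of_le ht.1]
    exact (continuousOn_duhamelLimit hα hμ Γ₀ (hIk (k + 1))).mono (Icc_subset_Icc_right ht.2)
  refine ⟨duhamelLimit μ Γ₀, ⟨MemC.of_norm_le hη.le
    (fun k => continuousOn_duhamelLimit hα hμ Γ₀ (hIk k)) hBs hle, hint, fun k t ht => ?_⟩,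
    duhamelLimit_zero_right μ Γ₀, fun t ht => ?_, fun m => ?_, fun ε hε => ?_⟩
  · rw [duhamelLimit_zero_right]
    -- Both sides of the recursion for the iterates converge, and the limit identity is the mild
    -- equation.
    refine tendsto_nhds_unique
      ((tendsto_duhamelIterate hα hμ Γ₀ ht (hIk k)).comp (tendsto_add_atTop_nat 1)) ?_
    exact (tendsto_integral_duhamelIntegrand_duhamelIterate hα hμ Γ₀ ht (hIk (k + 1))
      (hint k t ht)).const_add (freeEvolution t (Γ₀ k))
  · refine (hnorm_le_of_norm_le hη.le hBs (hle t ht)).trans (le_of_eq ?_)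
    rw [tsum_weighted_tsum (B := duhamelBound _ _) hB.summable, hB.tsum_eq, hξ]
    rfl
  · exact MemC.of_norm_le hη.le (fun k => (continuous_duhamelIterate μ Γ₀ m k).continuousOn) hBs
      fun t ht k => norm_duhamelIterate_le_tsum hα hμ Γ₀ ht m (hBk k)
  · have hI0 : ∀ k m, 0 ≤ incrementBound (hierarchyConst n α * T) (fun N => ‖Γ₀ N‖) k m :=
      fun k m => add_nonneg (duhamelBound_nonneg hx (fun N => by positivity) _ _)
        (duhamelBound_nonneg hx ha _ _)
    have hts : ∀ M k, ∑' j, incrementBound (hierarchyConst n α * T) (fun N => ‖Γ₀ N‖) k (j + M) ≤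
        ∑' j, incrementBound (hierarchyConst n α * T) (fun N => ‖Γ₀ N‖) k j := fun M k => by
      rw [← (hIk k).sum_add_tsum_nat_add M]
      exact le_add_of_nonneg_left (Finset.sum_nonneg fun j _ => hI0 k j)
    have hIs := summable_weighted_tsum (B := incrementBound _ _) hI
    have hsM : ∀ M, Summable fun k => η ^ (k + 1) * ∑' j,
        incrementBound (hierarchyConst n α * T) (fun N => ‖Γ₀ N‖) k (j + M) := fun M =>
      Summable.of_nonneg_of_le
        (fun k => mul_nonneg (by positivity) (tsum_nonneg fun j => hI0 k _))
        (fun k => mul_le_mul_of_nonneg_left (hts M k) (by positivity)) hIs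
    -- The tails are taken at the final time `T`, so their decay gives convergence uniform in `t`.
    have key : Tendsto (fun M => ∑' k, η ^ (k + 1) * ∑' j,
        incrementBound (hierarchyConst n α * T) (fun N => ‖Γ₀ N‖) k (j + M)) atTop
        (𝓝 (∑' _ : ℕ, (0 : ℝ))) := by
      refine tendsto_tsum_of_dominated_convergence hIs (fun k => ?_)
        (Eventually.of_forall fun M k => ?_)
      · simpa using (tendsto_sum_nat_add _).const_mul (η ^ (k + 1))
      · rw [Real.norm_of_nonneg (mul_nonneg (by positivity) (tsum_nonneg fun j => hI0 k _))]
        exact mul_le_mul_of_nonneg_left (hts M k) (by positivity)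
    rw [tsum_zero] at key
    obtain ⟨M, hM⟩ := eventually_atTop.1 (key.eventually_le_const hε)
    exact ⟨M, fun m hm t ht => (hnorm_le_of_norm_le hη.le (hsM m) fun k =>
      norm_duhamelIterate_sub_duhamelLimit_le hα hμ Γ₀ ht (hIk k) m).trans (hM m hm)⟩

/-! ### Stability and uniqueness -/

/-- The remainder equals `K / η^(k+1)` times `binom(m+k, k) (x/η)^m`: a polynomial in `m` against a
decaying geometric factor. -/
theorem tendsto_duhamelBound_geometric {x η K : ℝ} (hx : 0 ≤ x) (hη : 0 < η) (h : x < η) (k : ℕ) :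
    Tendsto (fun m => duhamelBound x (fun N => K / η ^ (N + 1)) k m) atTop (𝓝 0) := by
  have hr : ‖x / η‖ < 1 := by
    rw [Real.norm_of_nonneg (by positivity)]
    exact (div_lt_one hη).2 h
  have := ((summable_choose_mul_geometric_of_norm_lt_one k hr).tendsto_atTop_zero).mul_const
    (K / η ^ (k + 1))
  rw [zero_mul] at this
  refine this.congr fun m => ?_
  rw [duhamelBound, add_comm m k, div_pow]
  field_simp
  ring

theorem norm_le_tsum_duhamelBound {n : ℕ} {α : ℝ≥0} (hα : (n : ℝ) / 2 < α) {μ : ℝ}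
    (hμ : |μ| = 1) {Γ : ℝ → Seq n α} {b T η K : ℝ} {a : ℕ → ℝ} (ha : ∀ N, 0 ≤ a N)
    (hη : 0 < η) (hT : hierarchyConst n α * (T - b) < η)
    (hΓ : ∀ k, ∀ t ∈ Icc b T,
      ‖Γ t k‖ ≤ a k + ‖∫ s in b..t, duhamelIntegrand μ Γ k t s‖)
    (hK : ∀ k, ∀ t ∈ Icc b T, ‖Γ t k‖ ≤ K / η ^ (k + 1)) {k : ℕ}
    (hs : Summable (duhamelBound (hierarchyConst n α * (T - b)) a k)) {t : ℝ}
    (ht : t ∈ Icc b T) :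
    ‖Γ t k‖ ≤ ∑' j, duhamelBound (hierarchyConst n α * (T - b)) a k j := by
  have hC := hierarchyConst_pos n α
  have hx : 0 ≤ hierarchyConst n α * (t - b) := mul_nonneg hC.le (sub_nonneg.2 ht.1)
  have hxT : hierarchyConst n α * (t - b) ≤ hierarchyConst n α * (T - b) :=
    mul_le_mul_of_nonneg_left (sub_le_sub_right ht.2 b) hC.le
  have h0 := (tendsto_duhamelBound_geometric (K := K) hx hη (hxT.trans_lt hT) k).const_add
    (∑' j, duhamelBound (hierarchyConst n α * (T - b)) a k j)
  rw [add_zero] at h0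
  refine ge_of_tendsto h0 (Eventually.of_forall fun m =>
    (norm_le_sum_duhamelBound_add hα hμ hΓ hK m k ht).trans (add_le_add_left ?_ _))
  refine (Finset.sum_le_sum fun j _ => duhamelBound_mono hx hxT ha k j).trans
    (hs.sum_le_tsum _ fun j _ => duhamelBound_nonneg (hx.trans hxT) ha k j)

section Difference

variable {n : ℕ} {α : ℝ≥0} {μ T η : ℝ} {Γ Γ' : ℝ → Seq n α}

theorem IsMildSolution.sub_apply_eq (h : IsMildSolution μ T η Γ) (h' : IsMildSolution μ T η Γ')
    (k : ℕ) {t : ℝ} (ht : t ∈ Icc 0 T) :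
    (Γ t - Γ' t) k = freeEvolution t ((Γ 0 - Γ' 0) k) +
      ∫ s in (0 : ℝ)..t, duhamelIntegrand μ (fun s => Γ s - Γ' s) k t s := by
  simp only [duhamelIntegrand_sub]
  rw [intervalIntegral.integral_sub (h.integrable k t ht) (h'.integrable k t ht), Pi.sub_apply,
    h.eq k t ht, h'.eq k t ht, Pi.sub_apply, freeEvolution_sub]
  abel

theorem IsMildSolution.intervalIntegrable_sub (h : IsMildSolution μ T η Γ)
    (h' : IsMildSolution μ T η Γ') (k : ℕ) {t : ℝ} (ht : t ∈ Icc 0 T) :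
    IntervalIntegrable (duhamelIntegrand μ (fun s => Γ s - Γ' s) k t) volume 0 t :=
  ((h.integrable k t ht).sub (h'.integrable k t ht)).congr
    fun s _ => (duhamelIntegrand_sub μ Γ Γ' k t s).symm

theorem IsMildSolution.exists_norm_sub_le (hη : 0 < η) (h : IsMildSolution μ T η Γ)
    (h' : IsMildSolution μ T η Γ') :
    ∃ K, ∀ k, ∀ t ∈ Icc 0 T, ‖(Γ t - Γ' t) k‖ ≤ K / η ^ (k + 1) := by
  obtain ⟨M, hM⟩ := h.memC.exists_hnorm_le hη.le
  obtain ⟨M', hM'⟩ := h'.memC.exists_hnorm_le hη.le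
  refine ⟨M + M', fun k t ht => (norm_sub_le _ _).trans ?_⟩
  rw [add_div]
  refine add_le_add ((norm_le_hnorm_div hη (h.memC.mem t ht) k).trans ?_)
    ((norm_le_hnorm_div hη (h'.memC.mem t ht) k).trans ?_)
  · exact div_le_div_of_nonneg_right (hM t ht) (by positivity)
  · exact div_le_div_of_nonneg_right (hM' t ht) (by positivity)

theorem IsMildSolution.hnorm_sub_le (hα : (n : ℝ) / 2 < α) (hμ : |μ| = 1) {ξ : ℝ} (hη : 0 < η)
    (hT : 0 ≤ T) (hξ : η + hierarchyConst n α * T = ξ) (hTη : hierarchyConst n α * T < η)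
    (h : IsMildSolution μ T η Γ) (h' : IsMildSolution μ T η Γ')
    (h0 : Γ 0 ∈ HSpace n α ξ) (h0' : Γ' 0 ∈ HSpace n α ξ) {t : ℝ} (ht : t ∈ Icc 0 T) :
    hnorm η (Γ t - Γ' t) ≤ η / ξ * hnorm ξ (Γ 0 - Γ' 0) := by
  have hx : 0 ≤ hierarchyConst n α * T := mul_nonneg (hierarchyConst_pos n α).le hT
  obtain ⟨K, hK⟩ := h.exists_norm_sub_le hη h'
  have ha : ∀ N, 0 ≤ ‖(Γ 0 - Γ' 0) N‖ := fun _ => norm_nonneg _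
  have hsa : Summable fun N => (η + hierarchyConst n α * T) ^ (N + 1) * ‖(Γ 0 - Γ' 0) N‖ := by
    rw [hξ]
    exact HSpace.sub_mem (by linarith) h0 h0'
  have hB := hasSum_duhamelBound hη hx ha hsa
  have hBk := summable_of_summable_weighted (B := duhamelBound _ _) hη hB.summable
  have key : ∀ k, ‖(Γ t - Γ' t) k‖ ≤ ∑' j,
      duhamelBound (hierarchyConst n α * T) (fun N => ‖(Γ 0 - Γ' 0) N‖) k j := by
    intro k
    have := norm_le_tsum_duhamelBound hα hμ (Γ := fun t => Γ t - Γ' t) (b := 0) (T := T)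
      (k := k) ha hη (by rwa [sub_zero])
      (fun k t ht => by
        rw [h.sub_apply_eq h' k ht, ← norm_freeEvolution t ((Γ 0 - Γ' 0) k)]
        exact norm_add_le _ _)
      hK (by rw [sub_zero]; exact hBk k) ht
    rwa [sub_zero] at this
  refine (hnorm_le_of_norm_le hη.le
    (summable_weighted_tsum (B := duhamelBound _ _) hB.summable) key).trans (le_of_eq ?_)
  rw [tsum_weighted_tsum (B := duhamelBound _ _) hB.summable, hB.tsum_eq, hξ]
  rfl

/-- Agreement up to `b` removes the data and the integral over `[0, b]`, so the difference on `[b,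
c]` satisfies the iteration with zero data. Only the length `c - b` matters. -/
theorem IsMildSolution.eq_of_eq_of_le (hα : (n : ℝ) / 2 < α) (hμ : |μ| = 1) (hη : 0 < η)
    (h : IsMildSolution μ T η Γ) (h' : IsMildSolution μ T η Γ') {b c : ℝ} (hb : 0 ≤ b)
    (hcT : c ≤ T) (hcη : hierarchyConst n α * (c - b) < η)
    (heq : ∀ t ∈ Icc 0 b, Γ t = Γ' t) : ∀ t ∈ Icc 0 c, Γ t = Γ' t := by
  intro t ht
  rcases le_total t b with htb | htb
  · exact heq t ⟨ht.1, htb⟩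
  obtain ⟨K, hK⟩ := h.exists_norm_sub_le hη h'
  have hzero : ∀ k t, ∀ s ∈ uIcc 0 b, duhamelIntegrand μ (fun s => Γ s - Γ' s) k t s = 0 := by
    intro k t s hs
    rw [uIcc_of_le hb] at hs
    have := norm_duhamelIntegrand_le hα hμ (fun s => Γ s - Γ' s) k t s
    rw [heq s hs, sub_self, Pi.zero_apply, norm_zero, mul_zero] at this
    exact norm_le_zero_iff.1 this
  have hD : ∀ k, ∀ t ∈ Icc b c, ‖(Γ t - Γ' t) k‖ ≤
      0 + ‖∫ s in b..t, duhamelIntegrand μ (fun s => Γ s - Γ' s) k t s‖ := by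
    intro k t ht
    have ht' : t ∈ Icc 0 T := ⟨hb.trans ht.1, ht.2.trans hcT⟩
    have hi := h.intervalIntegrable_sub h' k ht'
    have hb' : b ∈ uIcc 0 t := by
      rw [uIcc_of_le ht'.1]; exact ⟨hb, ht.1⟩
    have hsplit := intervalIntegral.integral_add_adjacent_intervals
      (hi.mono_set (uIcc_subset_uIcc_left hb')) (hi.mono_set (uIcc_subset_uIcc_right hb'))
    rw [intervalIntegral.integral_congr (hzero k t), intervalIntegral.integral_zero,
      zero_add] at hsplit
    rw [h.sub_apply_eq h' k ht', ← hsplit]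
    refine (norm_add_le _ _).trans (add_le_add_left ?_ _)
    rw [norm_freeEvolution, heq 0 ⟨le_rfl, hb⟩, sub_self]
    exact norm_zero.le
  funext k
  have hz : duhamelBound (hierarchyConst n α * (c - b)) (fun _ => 0) k = fun _ => 0 := by
    funext j
    simp [duhamelBound]
  have := norm_le_tsum_duhamelBound hα hμ (Γ := fun t => Γ t - Γ' t) (a := fun _ => 0)
    (k := k) (fun _ => le_rfl) hη hcη hD
    (fun k t ht => hK k t ⟨hb.trans ht.1, ht.2.trans hcT⟩)
    (by rw [hz]; exact summable_zero) ⟨htb, ht.2⟩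
  rw [hz, tsum_zero] at this
  exact sub_eq_zero.1 (norm_le_zero_iff.1 this)

theorem IsMildSolution.unique (hα : (n : ℝ) / 2 < α) (hμ : |μ| = 1) (hη : 0 < η) (hT : 0 ≤ T)
    (h : IsMildSolution μ T η Γ) (h' : IsMildSolution μ T η Γ') (h0 : Γ 0 = Γ' 0) :
    ∀ t ∈ Icc 0 T, Γ t = Γ' t := by
  have hC := hierarchyConst_pos n α
  -- With this step `C δ = η/2 < η`, and `δ` is the same at every restart, so finitely many steps
  -- cover `[0, T]`.
  set δ := η / (2 * hierarchyConst n α) with hδ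
  have hδ0 : 0 < δ := by positivity
  have key : ∀ N : ℕ, ∀ t ∈ Icc 0 (min T (N * δ)), Γ t = Γ' t := by
    intro N
    induction N with
    | zero =>
      intro t ht
      have : t = 0 := le_antisymm (ht.2.trans ((min_le_right _ _).trans (by simp))) ht.1
      rw [this, h0]
    | succ N ih =>
      refine h.eq_of_eq_of_le hα hμ hη h' (b := min T (N * δ)) (le_min hT (by positivity))
        (min_le_left _ _) ?_ ih
      · have h1 : min T ((N + 1 : ℕ) * δ) - min T (N * δ) ≤ δ := by
          push_cast
          rcases min_cases T (N * δ) with h1 | h1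
          · linarith [min_le_left T ((N + 1 : ℝ) * δ)]
          · linarith [min_le_right T ((N + 1 : ℝ) * δ)]
        have h2 : hierarchyConst n α * δ = η / 2 := by
          rw [hδ]; field_simp
        linarith [mul_le_mul_of_nonneg_left h1 hC.le]
  obtain ⟨N, hN⟩ := exists_nat_ge (T / δ)
  have := key N
  rwa [min_eq_left ((div_le_iff₀ hδ0).1 hN)] at this

end Difference

end GP

end

theorem theorem2p1 (n : ℕ) (hn : 1 ≤ n) (α : ℝ≥0) (hα : (n : ℝ) / 2 < α) :
    ∃ C : ℝ, 0 < C ∧ ∀ μ : ℝ, (μ = 1 ∨ μ = -1) → ∀ ξ : ℝ, 0 < ξ → ξ < 1 →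
      -- existence, with the bound, as the limit of the iterated Duhamel expansion
      (∀ Γ₀ ∈ GP.HSpace n α ξ, ∀ T : ℝ, 0 < T → T < ξ / C → ∀ η : ℝ, η = ξ - C * T →
        ∃ Γ : ℝ → GP.Seq n α, GP.IsMildSolution μ T η Γ ∧ Γ 0 = Γ₀ ∧
          (∀ t ∈ Set.Icc 0 T, GP.hnorm η (Γ t) ≤ η / ξ * GP.hnorm ξ Γ₀) ∧
          (∀ m, GP.MemC T η (GP.duhamelIterate μ Γ₀ m)) ∧
          ∀ ε : ℝ, 0 < ε → ∃ M : ℕ, ∀ m ≥ M, ∀ t ∈ Set.Icc 0 T,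
            GP.hnorm η (GP.duhamelIterate μ Γ₀ m t - Γ t) ≤ ε) ∧
      -- stability for `T = ξ / (5 C)`
      (∀ T η : ℝ, T = ξ / (5 * C) → η = ξ - C * T → ∀ Γ Γ' : ℝ → GP.Seq n α,
        GP.IsMildSolution μ T η Γ → GP.IsMildSolution μ T η Γ' →
        Γ 0 ∈ GP.HSpace n α ξ → Γ' 0 ∈ GP.HSpace n α ξ →
        ∀ t ∈ Set.Icc 0 T, GP.hnorm η (Γ t - Γ' t) ≤ 4 / 5 * GP.hnorm ξ (Γ 0 - Γ' 0)) ∧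
      -- uniqueness for every admissible `T`
      (∀ T : ℝ, 0 < T → T < ξ / C → ∀ η : ℝ, η = ξ - C * T → ∀ Γ Γ' : ℝ → GP.Seq n α,
        GP.IsMildSolution μ T η Γ → GP.IsMildSolution μ T η Γ' →
        Γ 0 ∈ GP.HSpace n α ξ → Γ 0 = Γ' 0 → ∀ t ∈ Set.Icc 0 T, Γ t = Γ' t) := by
  have hC := GP.hierarchyConst_pos n α
  refine ⟨GP.hierarchyConst n α, hC, fun μ hμ ξ hξ _ => ?_⟩
  have hμ' : |μ| = 1 := by rcases hμ with rfl | rfl <;> simp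
  refine ⟨fun Γ₀ hΓ₀ T hT hTξ η hη => ?_, fun T η hT hη Γ Γ' h h' h0 h0' t ht => ?_,
    fun T hT hTξ η hη Γ Γ' h h' _ h0 => ?_⟩
  · have hTC : GP.hierarchyConst n α * T < ξ := by rwa [lt_div_iff₀' hC] at hTξ
    exact GP.exists_isMildSolution hα hμ' (by linarith) hT.le (by linarith) hΓ₀
  -- Here `CT = ξ/5` lies below `η = 4ξ/5`, so the remainder vanishes in one step, and `η/ξ = 4/5`.
  · have hTC : GP.hierarchyConst n α * T = ξ / 5 := by rw [hT]; field_simp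
    have hη' : η = 4 / 5 * ξ := by linarith
    have := h.hnorm_sub_le hα hμ' (ξ := ξ) (by linarith) (by rw [hT]; positivity)
      (by linarith) (by linarith) h' h0 h0' ht
    rwa [hη', mul_div_cancel_right₀ _ hξ.ne', ← hη'] at this
  · have hTC : GP.hierarchyConst n α * T < ξ := by rwa [lt_div_iff₀' hC] at hTξ
    exact h.unique hα hμ' (by linarith) hT.le h' h0
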